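/- Let $G$ be an arbitrary group, let $\mathbb{Z}G$ be its integral group ring with group of units $U(\mathbb{Z}G)$, and let $*$ be the $\mathbb{Z}$-linear extension to $\mathbb{Z}G$ of the map $g\mapsto g^{-1}$ on $G$. Let $S_*(\mathbb{Z}G)=\{x\in U(\mathbb{Z}G) : x^*=x\}$ be the set of symmetric units, and let $t(G)$ be the set of elements of $G$ of finite order. (1) If $S_*(\mathbb{Z}G)$ is a subgroup of $U(\mathbb{Z}G)$, then $t(G)$ is a subgroup of $G$, every subgroup of $t(G)$ is normal in $G$, and $t(G)$ is either abelian or a hamiltonian $2$-group (that is, a nonabelian $2$-group all of whose subgroups are normal). (2) Conversely, suppose that $t(G)$ is a subgroup of $G$, that every subgroup of $t(G)$ is normal in $G$, that $t(G)$ is either abelian or a hamiltonian $2$-group, and that $G/t(G)$ is right ordered, i.e. admits a total order $\le$ such that $a\le b$ implies $ac\le bc$ for all $a,b,c\in G/t(G)$. Then $S_*(\mathbb{Z}G)$ is a subgroup of $U(\mathbb{Z}G)$. -/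

import Mathlib

/-- The `ℤ`-linear extension to the integral group ring `ℤG` of the map `g ↦ g⁻¹`,
i.e. `∑ a_g g ↦ ∑ a_g g⁻¹`. -/
noncomputable def groupRingStar {G : Type*} [Group G] :
    MonoidAlgebra ℤ G →ₗ[ℤ] MonoidAlgebra ℤ G :=
  MonoidAlgebra.mapDomainLinearMap ℤ ℤ (fun g : G => g⁻¹)

/-- The set `S_*(ℤG)` of symmetric units of the integral group ring. -/
def symmetricUnits (G : Type*) [Group G] : Set (MonoidAlgebra ℤ G)ˣ :=
  {x | groupRingStar (x : MonoidAlgebra ℤ G) = x}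

/-- `S_*(ℤG)` is (the underlying set of) a subgroup of the unit group `U(ℤG)`. -/
def SymmetricUnitsFormSubgroup (G : Type*) [Group G] : Prop :=
  ∃ H : Subgroup (MonoidAlgebra ℤ G)ˣ, (H : Set (MonoidAlgebra ℤ G)ˣ) = symmetricUnits G

/-- The set `t(G)` of elements of finite order. -/
def torsionElements (G : Type*) [Group G] : Set G := {g | IsOfFinOrder g}

/-- A hamiltonian group: a nonabelian group all of whose subgroups are normal. -/
def IsHamiltonianGroup (G : Type*) [Group G] : Prop :=
  (∃ x y : G, x * y ≠ y * x) ∧ ∀ H : Subgroup G, H.Normal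

/-- A group is right ordered (right orderable) if it carries a total order that is preserved by
right multiplication. -/
def IsRightOrderedGroup (G : Type*) [Group G] : Prop :=
  ∃ _ : LinearOrder G, ∀ a b c : G, a ≤ b → a * c ≤ b * c

/-- The subgroup `T` has as its elements exactly those of `t(G)`, every subgroup of `T` is normal
in `G`, and `T` is abelian or a hamiltonian `2`-group. -/
structure TorsionConditions {G : Type*} [Group G] (T : Subgroup G) : Prop where
  coe_eq : (T : Set G) = torsionElements G
  normal_of_le : ∀ H : Subgroup G, H ≤ T → H.Normal
  abelian_or_hamiltonian :
    (∀ x y : T, x * y = y * x) ∨ (IsHamiltonianGroup T ∧ IsPGroup 2 T)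

/-! Since `*` reverses products, the symmetric units form a subgroup exactly when they commute
pairwise. The coefficient of `1` in `x* x` is a sum of squares, so `x* x = 0` forces `x = 0`; this
positivity is used throughout.

Necessity. If `x² = 0`, then `(1 + x)(1 + x*)` and `(1 + x*)(1 + x)` are symmetric units; their
commuting together with positivity gives `x = 0`. Applied to `(a - 1) g (1 + a + ⋯)` with `a`
torsion, this makes every finite cyclic subgroup normal, so `t(G)` is a subgroup all of whose
subgroups are normal in `G`. If `t(G)` is nonabelian, a noncommuting torsion pair of least total
order generates a quaternion group of order 8 (`isQuaternionPair_of_minimal`). An element `c` of odd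
order centralizes this group, and comparing symmetric Bass units built on `ac` and `bc` forces `c =
1` (`eq_one_of_isQuaternionPair`). Hence `t(G)` is a 2-group.

Sufficiency. Let `T = t(G)` and grade `ℤG` by `G/T`. Either `T` is abelian, or `T` has exponent
dividing 4 and `u + u*` is central for every `u` in `ℤT`; in both cases symmetric elements of `ℤT`
commute with all of `ℤT`. It remains to see that symmetric units lie in `ℤT`. For homogeneous
elements, `uv = 0` implies `u ℤG v = 0` (`TorsionConditions.mul_mul_of_mul_eq_zero`). With the right
order on `G/T` this shows that the components of a unit in two different degrees have product zero
(`TorsionConditions.cosetComponent_mul_eq_zero`). For a symmetric unit the component of degree `q⁻¹`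
is the star of that of degree `q`, so positivity kills every component with `q ≠ 1`. -/

/-! ### The involution, its positivity, and commuting symmetric units. -/

open MonoidAlgebra in
theorem groupRingStar_single {G : Type*} [Group G] (g : G) (r : ℤ) :
    groupRingStar (single g r) = single g⁻¹ r := by
  simp [groupRingStar]

theorem groupRingStar_of {G : Type*} [Group G] (g : G) :
    groupRingStar (MonoidAlgebra.of ℤ G g) = MonoidAlgebra.of ℤ G g⁻¹ := by
  simp [groupRingStar_single]

theorem groupRingStar_one {G : Type*} [Group G] :
    groupRingStar (1 : MonoidAlgebra ℤ G) = 1 := by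
  simp [MonoidAlgebra.one_def, groupRingStar_single]

theorem groupRingStar_groupRingStar {G : Type*} [Group G] (x : MonoidAlgebra ℤ G) :
    groupRingStar (groupRingStar x) = x := by
  induction x using MonoidAlgebra.induction_linear with
  | zero => simp
  | add x y hx hy => rw [map_add, map_add, hx, hy]
  | single g r => simp [groupRingStar_single]

theorem groupRingStar_mul {G : Type*} [Group G] (x y : MonoidAlgebra ℤ G) :
    groupRingStar (x * y) = groupRingStar y * groupRingStar x := by
  induction x using MonoidAlgebra.induction_linear with
  | zero => simp
  | add x x' hx hx' => rw [add_mul, map_add, map_add, hx, hx', mul_add]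
  | single g r =>
    induction y using MonoidAlgebra.induction_linear with
    | zero => simp
    | add y y' hy hy' => rw [mul_add, map_add, map_add, hy, hy', add_mul]
    | single h s => simp [groupRingStar_single, MonoidAlgebra.single_mul_single, mul_comm]

theorem coeff_groupRingStar {G : Type*} [Group G] (x : MonoidAlgebra ℤ G) (g : G) :
    (groupRingStar x).coeff g = x.coeff g⁻¹ := by
  classical
  induction x using MonoidAlgebra.induction_linear with
  | zero => simp
  | add x y hx hy => simp [hx, hy]
  | single h r => simp [groupRingStar_single, Finsupp.single_apply, inv_eq_iff_eq_inv]

theorem coeff_one_groupRingStar_mul {G : Type*} [Group G] (x y : MonoidAlgebra ℤ G) :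
    (groupRingStar x * y).coeff 1 = x.coeff.sum fun g r => r * y.coeff g := by
  induction x using MonoidAlgebra.induction_linear with
  | zero => simp
  | add x x' hx hx' =>
    rw [map_add, add_mul, MonoidAlgebra.coeff_add, Finsupp.add_apply, hx, hx',
      MonoidAlgebra.coeff_add, Finsupp.sum_add_index' (by simp) (by simp [add_mul])]
  | single h r => simp [groupRingStar_single]

/-- The coefficient of `1` in `x* x` is the sum of the squares of the coefficients of `x`. -/
theorem eq_zero_of_groupRingStar_mul_self {G : Type*} [Group G] {x : MonoidAlgebra ℤ G}
    (h : groupRingStar x * x = 0) : x = 0 := by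
  have h1 := coeff_one_groupRingStar_mul x x
  rw [h, Finsupp.sum] at h1
  simp only [MonoidAlgebra.coeff_zero, Finsupp.coe_zero, Pi.zero_apply] at h1
  have h2 := (Finset.sum_eq_zero_iff_of_nonneg (fun g _ => mul_self_nonneg (x.coeff g))).1 h1.symm
  ext g
  by_contra hg
  exact hg (mul_self_eq_zero.1 (h2 g (Finsupp.mem_support_iff.2 hg)))

theorem eq_zero_of_mul_groupRingStar_self {G : Type*} [Group G] {x : MonoidAlgebra ℤ G}
    (h : x * groupRingStar x = 0) : x = 0 := by
  have := eq_zero_of_groupRingStar_mul_self (x := groupRingStar x)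
    (by rwa [groupRingStar_groupRingStar])
  rw [← groupRingStar_groupRingStar x, this, map_zero]

theorem symmetricUnitsFormSubgroup_iff {G : Type*} [Group G] :
    SymmetricUnitsFormSubgroup G ↔
      ∀ x ∈ symmetricUnits G, ∀ y ∈ symmetricUnits G, x * y = y * x := by
  constructor
  · rintro ⟨H, hH⟩ x hx y hy
    have hxy : x * y ∈ symmetricUnits G := by
      rw [← hH] at hx hy ⊢
      exact H.mul_mem hx hy
    simp only [symmetricUnits, Set.mem_ofPred_eq] at hx hy hxy
    ext1
    rw [← hxy, Units.val_mul, groupRingStar_mul, hx, hy, Units.val_mul]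
  · intro h
    refine ⟨{ carrier := symmetricUnits G, mul_mem' := ?_, one_mem' := ?_, inv_mem' := ?_ }, rfl⟩
    · intro x y hx hy
      have := congrArg Units.val (h x hx y hy)
      simp only [symmetricUnits, Set.mem_ofPred_eq, Units.val_mul] at *
      rw [groupRingStar_mul, hx, hy, this]
    · simp [symmetricUnits, groupRingStar_one]
    · intro x hx
      simp only [symmetricUnits, Set.mem_ofPred_eq] at *
      refine (Units.inv_eq_of_mul_eq_one_right ?_).symm
      calc (x : MonoidAlgebra ℤ G) * groupRingStar ((x⁻¹ : (MonoidAlgebra ℤ G)ˣ) : MonoidAlgebra ℤ G)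
          = groupRingStar (x : MonoidAlgebra ℤ G) *
            groupRingStar ((x⁻¹ : (MonoidAlgebra ℤ G)ˣ) : MonoidAlgebra ℤ G) := by rw [hx]
        _ = 1 := by rw [← groupRingStar_mul, Units.inv_mul, groupRingStar_one]

/-! ### Square-zero elements and normality of finite cyclic subgroups. -/

theorem mul_mul_eq_of_commute_of_sq_zero {R : Type*} [Ring R] [IsAddTorsionFree R] {x y : R}
    (hx : x * x = 0) (hy : y * y = 0)
    (h : (1 + x) * (1 + y) * ((1 + y) * (1 + x)) = (1 + y) * (1 + x) * ((1 + x) * (1 + y))) :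
    x * y * x = y * x * y := by
  have h1 : (1 + x) * (1 + y) * ((1 + y) * (1 + x)) =
      1 + 2 • x + 2 • y + 2 • (x * y) + 2 • (y * x) + 2 • (x * y * x)
      + (x * x + y * y + x * (y * y) + (y * y) * x + x * (y * y) * x) := by noncomm_ring
  have h2 : (1 + y) * (1 + x) * ((1 + x) * (1 + y)) =
      1 + 2 • x + 2 • y + 2 • (x * y) + 2 • (y * x) + 2 • (y * x * y)
      + (x * x + y * y + y * (x * x) + (x * x) * y + y * (x * x) * y) := by noncomm_ring
  rw [h1, h2] at h
  simp only [hx, hy, mul_zero, zero_mul, add_zero] at h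
  exact nsmul_right_injective two_ne_zero (add_left_cancel h)

theorem eq_zero_of_symmetricUnits_commute_of_sq_zero {G : Type*} [Group G]
    (hS : ∀ x ∈ symmetricUnits G, ∀ y ∈ symmetricUnits G, x * y = y * x)
    {x : MonoidAlgebra ℤ G} (hx : x * x = 0) : x = 0 := by
  have : IsAddTorsionFree (MonoidAlgebra ℤ G) := 
    Function.Injective.isAddTorsionFree (MonoidAlgebra.coeffAddEquiv (R := ℤ) (M := G)).toAddMonoidHom
      (MonoidAlgebra.coeffAddEquiv).injective
  have hy : groupRingStar x * groupRingStar x = 0 := by rw [← groupRingStar_mul, hx, map_zero]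
  let u : (MonoidAlgebra ℤ G)ˣ := ⟨1 + x, 1 - x, by noncomm_ring; simp [hx], by noncomm_ring; simp [hx]⟩
  let v : (MonoidAlgebra ℤ G)ˣ := ⟨1 + groupRingStar x, 1 - groupRingStar x,
    by noncomm_ring; simp [hy], by noncomm_ring; simp [hy]⟩
  have huv : u * v ∈ symmetricUnits G := by
    simp [symmetricUnits, u, v, groupRingStar_mul, groupRingStar_one, groupRingStar_groupRingStar]
  have hvu : v * u ∈ symmetricUnits G := by
    simp [symmetricUnits, u, v, groupRingStar_mul, groupRingStar_one, groupRingStar_groupRingStar]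
  have h := mul_mul_eq_of_commute_of_sq_zero hx hy (congrArg Units.val (hS _ huv _ hvu))
  -- The element `x x*` is symmetric, and its square is `x (x* x x*) = x (x x* x) = 0`; positivity
  -- then applies twice.
  have h1 : groupRingStar (x * groupRingStar x) * (x * groupRingStar x) = 0 := by
    rw [groupRingStar_mul, groupRingStar_groupRingStar,
      show x * groupRingStar x * (x * groupRingStar x)
        = x * (groupRingStar x * x * groupRingStar x) by noncomm_ring, ← h,
      show x * (x * groupRingStar x * x) = x * x * groupRingStar x * x by noncomm_ring, hx]
    simp
  exact eq_zero_of_mul_groupRingStar_self (eq_zero_of_groupRingStar_mul_self h1)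

theorem conj_mem_zpowers_of_symmetricUnits_commute {G : Type*} [Group G]
    (hS : ∀ x ∈ symmetricUnits G, ∀ y ∈ symmetricUnits G, x * y = y * x)
    {a : G} (ha : IsOfFinOrder a) (g : G) : g⁻¹ * a * g ∈ Subgroup.zpowers a := by
  classical
  let A := MonoidAlgebra.of ℤ G a
  let s := ∑ i ∈ Finset.range (orderOf a), A ^ i
  have hs : s * (A - 1) = 0 := by
    rw [geom_sum_mul, ← map_pow, pow_orderOf_eq_one, map_one, sub_self]
  have hs_coeff (h : G) : s.coeff h =
      ∑ i ∈ Finset.range (orderOf a), if a ^ i = h then (1 : ℤ) else 0 := by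
    simp [s, A, MonoidAlgebra.single_pow, Finsupp.single_apply]
  -- As `s (A - 1) = 0`, this product has square zero for every `g`. Its vanishing says that `g⁻¹ a
  -- g` fixes `s`, hence lies in the support of `s`, which consists of powers of `a`.
  have hx := eq_zero_of_symmetricUnits_commute_of_sq_zero hS
    (x := (A - 1) * MonoidAlgebra.of ℤ G g * s) (by
      rw [show (A - 1) * MonoidAlgebra.of ℤ G g * s * ((A - 1) * MonoidAlgebra.of ℤ G g * s)
        = (A - 1) * MonoidAlgebra.of ℤ G g * (s * (A - 1)) * (MonoidAlgebra.of ℤ G g * s) by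
          noncomm_ring, hs]
      simp)
  have h1 : MonoidAlgebra.of ℤ G (g⁻¹ * a * g) * s = s := by
    have : MonoidAlgebra.of ℤ G g⁻¹ * ((A - 1) * MonoidAlgebra.of ℤ G g * s) =
        MonoidAlgebra.of ℤ G (g⁻¹ * a * g) * s - MonoidAlgebra.of ℤ G (g⁻¹ * g) * s := by
      simp only [map_mul, A]
      noncomm_ring
    rw [hx, inv_mul_cancel, map_one, one_mul, mul_zero] at this
    exact (sub_eq_zero.1 this.symm)
  have h2 : s.coeff (g⁻¹ * a * g) = s.coeff 1 := by
    conv_lhs => rw [← h1]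
    simp [mul_assoc]
  have h3 : 0 < s.coeff 1 := by
    rw [hs_coeff]
    refine Finset.sum_pos' (fun i _ => by split_ifs <;> simp) ⟨0, ?_, by simp⟩
    simpa using ha.orderOf_pos
  rw [← h2, hs_coeff] at h3
  obtain ⟨i, -, hi⟩ := Finset.exists_ne_zero_of_sum_ne_zero h3.ne'
  have : a ^ i = g⁻¹ * a * g := by by_contra h; simp [h] at hi
  exact this ▸ Subgroup.npow_mem_zpowers a i

/-! ### Noncommuting torsion elements yield a quaternion pair. -/

theorem mul_pow_of_mul_eq_mul_mul {G : Type*} [Group G] {b c w : G} (h : c * b = b * c * w)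
    (hb : Commute w b) (hc : Commute w c) (n : ℕ) :
    (b * c) ^ n = b ^ n * c ^ n * w ^ n.choose 2 := by
  have hcn : ∀ n : ℕ, c ^ n * b = b * c ^ n * w ^ n := by
    intro n
    induction n with
    | zero => simp
    | succ n ih =>
      rw [pow_succ', mul_assoc, ih, ← mul_assoc, ← mul_assoc, h, mul_assoc (b * c),
        (hc.pow_right n).eq, pow_succ' w]
      simp only [mul_assoc]
  induction n with
  | zero => simp
  | succ n ih =>
    have hk : Commute (w ^ n.choose 2) (b * c) := (hb.mul_right hc).pow_left _
    rw [pow_succ, ih, mul_assoc, hk.eq, ← mul_assoc, ← mul_assoc, mul_assoc (b ^ n), hcn]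
    have hk' : w ^ n * c = c * w ^ n := (hc.pow_left n).eq
    rw [show b ^ n * (b * c ^ n * w ^ n) * c = b ^ n * b * c ^ n * (w ^ n * c) by group, hk',
      Nat.choose_succ_succ' n 1, Nat.choose_one_right, show 1 + 1 = 2 from rfl, pow_add w,
      pow_succ b n, pow_succ c n]
    simp only [mul_assoc]

theorem prime_dvd_choose_two {p m : ℕ} (hp : p.Prime) (h : ¬ p ∣ (p ^ m).choose 2) :
    p = 2 ∧ m = 1 := by
  have hm : m ≠ 0 := by rintro rfl; simp at h
  have h2 : (p ^ m).choose 2 * 2 = p ^ m * (p ^ m - 1) := by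
    rw [Nat.choose_two_right]
    exact Nat.div_mul_cancel (Nat.even_mul_pred_self _).two_dvd
  have hp2 : p = 2 := by
    by_contra hne
    have : p ∣ (p ^ m).choose 2 * 2 := h2 ▸ (dvd_pow_self p hm).mul_right _
    rcases hp.dvd_mul.1 this with h3 | h3
    · exact h h3
    · exact hne ((Nat.prime_dvd_prime_iff_eq hp Nat.prime_two).1 h3)
  subst hp2
  refine ⟨rfl, ?_⟩
  by_contra hm1
  obtain ⟨k, rfl⟩ : ∃ k, m = k + 2 := ⟨m - 2, by omega⟩
  apply h
  have : (2 ^ (k + 2)).choose 2 = 2 * (2 ^ k * (2 ^ (k + 2) - 1)) := by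
    have : (2 ^ (k + 2)).choose 2 * 2 = (2 * (2 ^ k * (2 ^ (k + 2) - 1))) * 2 := by
      rw [h2]; ring
    omega
  exact ⟨_, this⟩

/-- Both `z` and `b ^ q` generate the unique subgroup of order `p` of the cyclic group `⟨b⟩`. -/
theorem exists_pow_eq_pow_mul_of_prime_orderOf {G : Type*} [Group G] {b z : G} {p q : ℕ}
    (hp : p.Prime) (hq : orderOf b = q * p) (hq0 : 0 < q) (hz : z ∈ Subgroup.zpowers b)
    (hz1 : z ≠ 1) (hzp : z ^ p = 1) : (∃ i, z = (b ^ q) ^ i) ∧ ∃ i, b ^ q = z ^ i := by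
  have hfin : IsOfFinOrder b := orderOf_pos_iff.1 (hq ▸ Nat.mul_pos hq0 hp.pos)
  obtain ⟨j, rfl⟩ := (hfin.mem_powers_iff_mem_zpowers.2 hz)
  simp only at hz1 hzp ⊢
  rw [← pow_mul, ← orderOf_dvd_iff_pow_eq_one, hq] at hzp
  obtain ⟨l, rfl⟩ := Nat.dvd_of_mul_dvd_mul_right hp.pos hzp
  refine ⟨⟨l, pow_mul b q l⟩, ?_⟩
  have hl : l.Coprime p := by
    rw [Nat.coprime_comm, hp.coprime_iff_not_dvd]
    rintro ⟨i, rfl⟩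
    exact hz1 (by rw [← mul_assoc, pow_mul, ← hq, pow_orderOf_eq_one, one_pow])
  obtain ⟨m, -, hm⟩ := Nat.exists_mul_mod_eq_one_of_coprime hl hp.one_lt
  refine ⟨m, ?_⟩
  have hbq : (b ^ q) ^ p = 1 := by rw [← pow_mul, ← hq, pow_orderOf_eq_one]
  rw [← pow_mul, mul_assoc, pow_mul, ← Nat.mod_add_div (l * m) p, hm, pow_add, pow_mul, hbq]
  simp

/-- The hypothesis that every finite cyclic subgroup of `G` is normal. -/
def FiniteCyclicSubgroupsNormal (G : Type*) [Group G] : Prop :=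
  ∀ a x : G, IsOfFinOrder a → x⁻¹ * a * x ∈ Subgroup.zpowers a

theorem commutator_mem_zpowers {G : Type*} [Group G] (hN : FiniteCyclicSubgroupsNormal G)
    {a b : G} (ha : IsOfFinOrder a) (hb : IsOfFinOrder b) :
    a⁻¹ * b⁻¹ * a * b ∈ Subgroup.zpowers a ∧ a⁻¹ * b⁻¹ * a * b ∈ Subgroup.zpowers b := by
  constructor
  · rw [show a⁻¹ * b⁻¹ * a * b = a⁻¹ * (b⁻¹ * a * b) by group]
    exact mul_mem (inv_mem (Subgroup.mem_zpowers a)) (hN a b ha)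
  · rw [show a⁻¹ * b⁻¹ * a * b = (a⁻¹ * b * a)⁻¹ * b by group]
    exact mul_mem (inv_mem (hN b a hb)) (Subgroup.mem_zpowers b)

theorem FiniteCyclicSubgroupsNormal.isOfFinOrder_mul {G : Type*} [Group G]
    (hN : FiniteCyclicSubgroupsNormal G)
    {a b : G} (ha : IsOfFinOrder a) (hb : IsOfFinOrder b) : IsOfFinOrder (a * b) := by
  have hn : (Subgroup.zpowers a).Normal := by
    refine ⟨fun n hn g => ?_⟩
    have h1 : IsOfFinOrder n := ha.of_mem_zpowers hn
    have h2 := hN n g⁻¹ h1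
    rw [inv_inv] at h2
    exact (Subgroup.zpowers_le.2 hn) h2
  obtain ⟨n, hn0, hn1⟩ := hb.exists_pow_eq_one
  have h : (a * b) ^ n ∈ Subgroup.zpowers a := by
    rw [← QuotientGroup.eq_one_iff, QuotientGroup.mk_pow, QuotientGroup.mk_mul,
      (QuotientGroup.eq_one_iff a).2 (Subgroup.mem_zpowers a), one_mul, ← QuotientGroup.mk_pow, hn1,
      QuotientGroup.mk_one]
  exact (ha.of_mem_zpowers h).of_pow hn0.ne'

/-- The elements `a` and `b` satisfy the relations of the standard generators of the quaternion
group of order `8`, and `a` has order `4`. -/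
structure IsQuaternionPair {G : Type*} [Group G] (a b : G) : Prop where
  pow_four : a ^ 4 = 1
  sq_ne_one : a ^ 2 ≠ 1
  sq_eq : b ^ 2 = a ^ 2
  mul_eq : a * b = b * a * a ^ 2

/-- The commutator `z` lies in `⟨a⟩ ∩ ⟨b⟩`, so it commutes with `a` and `b`. By minimality `a ^ p`
commutes with `b` for each prime `p` dividing the order of `a`, whence `z ^ p = 1`, and likewise for
`b`; so both orders are powers of a single prime `p`. Some `t` satisfies `(a ^ t) ^ p ^ m = b ^ p ^
m`, where `b` has order `p ^ (m + 1)`. Replacing `b` by `b a⁻ᵗ` would lower the total order unless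
`z⁻ᵗ` to the power `p ^ m` choose 2 is nontrivial, which leaves only `p = 2`, `m = 1` and `t` odd.
-/
theorem isQuaternionPair_of_minimal {G : Type*} [Group G] (hN : FiniteCyclicSubgroupsNormal G)
    {a b : G} (ha : IsOfFinOrder a) (hb : IsOfFinOrder b) (hab : ¬ Commute a b)
    (hle : orderOf b ≤ orderOf a)
    (hmin : ∀ a' b' : G, IsOfFinOrder a' → IsOfFinOrder b' → ¬ Commute a' b' →
      orderOf a + orderOf b ≤ orderOf a' + orderOf b') : IsQuaternionPair a b := by
  obtain ⟨hza, hzb⟩ := commutator_mem_zpowers hN ha hb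
  obtain ⟨z, hz⟩ : ∃ z, z = a⁻¹ * b⁻¹ * a * b := ⟨_, rfl⟩
  have habz : a * b = b * a * z := by rw [hz]; group
  rw [← hz] at hza hzb
  have hz1 : z ≠ 1 := fun h => hab (by rw [h, mul_one] at habz; exact habz)
  have hzca : Commute z a := by
    obtain ⟨i, hi⟩ := hza
    rw [← hi]; exact (Commute.refl a).zpow_left i
  have hzcb : Commute z b := by
    obtain ⟨i, hi⟩ := hzb
    rw [← hi]; exact (Commute.refl b).zpow_left i
  have hza_pow (n : ℕ) : Commute (a ^ n) b → z ^ n = 1 := fun h => by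
    have h1 : SemiconjBy b (a * z) a := by
      rw [SemiconjBy, habz, mul_assoc]
    have h2 := h1.pow_right n
    rw [hzca.symm.mul_pow] at h2
    have h3 : b * (a ^ n * z ^ n) = b * a ^ n := h2.trans h
    simpa using h3
  have hzb_pow (n : ℕ) : Commute a (b ^ n) → z ^ n = 1 := fun h => by
    have h1 : SemiconjBy a b (b * z) := by
      rw [SemiconjBy, habz, mul_assoc, hzca.symm.eq, ← mul_assoc]
    have h2 := h1.pow_right n
    rw [hzcb.symm.mul_pow] at h2
    have h3 : b ^ n * z ^ n * a = b ^ n * a := h2.symm.trans h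
    rw [mul_assoc] at h3
    simpa using h3
  have hpa : ∀ p : ℕ, p.Prime → p ∣ orderOf a → z ^ p = 1 := fun p hp hpd => by
    apply hza_pow
    by_contra hc
    have h1 := hmin _ _ ha.pow hb hc
    rw [orderOf_pow_of_dvd hp.ne_zero hpd] at h1
    have := Nat.div_lt_self ha.orderOf_pos hp.one_lt
    omega
  have hpb : ∀ p : ℕ, p.Prime → p ∣ orderOf b → z ^ p = 1 := fun p hp hpd => by
    apply hzb_pow
    by_contra hc
    have h1 := hmin _ _ ha hb.pow hc
    rw [orderOf_pow_of_dvd hp.ne_zero hpd] at h1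
    have := Nat.div_lt_self hb.orderOf_pos hp.one_lt
    omega
  have huniq : ∀ p r : ℕ, p.Prime → r.Prime → z ^ p = 1 → z ^ r = 1 → r = p :=
    fun p r hp hr h1 h2 => by
      rw [← orderOf_eq_prime h1 hz1 (hp := ⟨hp⟩), orderOf_eq_prime h2 hz1 (hp := ⟨hr⟩)]
  have ha1 : orderOf a ≠ 1 := fun h => hab (by rw [orderOf_eq_one_iff.1 h]; exact Commute.one_left b)
  have hb1 : orderOf b ≠ 1 := fun h => hab (by rw [orderOf_eq_one_iff.1 h]; exact Commute.one_right a)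
  obtain ⟨p, hp, hpd⟩ := Nat.exists_prime_and_dvd ha1
  have hzp := hpa p hp hpd
  have hoa := Nat.eq_prime_pow_of_unique_prime_dvd ha.orderOf_pos.ne'
    (fun {r} hr hrd => huniq p r hp hr hzp (hpa r hr hrd))
  have hob := Nat.eq_prime_pow_of_unique_prime_dvd hb.orderOf_pos.ne'
    (fun {r} hr hrd => huniq p r hp hr hzp (hpb r hr hrd))
  obtain ⟨k, hk⟩ : ∃ k, orderOf a = p ^ k * p := by
    rcases h : (orderOf a).primeFactorsList.length with _ | k
    · rw [h] at hoa; simp [ha1] at hoa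
    · exact ⟨k, by rw [hoa, h, pow_succ]⟩
  obtain ⟨m, hm⟩ : ∃ k, orderOf b = p ^ k * p := by
    rcases h : (orderOf b).primeFactorsList.length with _ | k
    · rw [h] at hob; simp [hb1] at hob
    · exact ⟨k, by rw [hob, h, pow_succ]⟩
  have hmk : m ≤ k := by
    rw [hk, hm] at hle
    exact (Nat.pow_le_pow_iff_right hp.one_lt).1 (Nat.le_of_mul_le_mul_right hle hp.pos)
  obtain ⟨⟨i, hi⟩, -⟩ := exists_pow_eq_pow_mul_of_prime_orderOf hp hk (pow_pos hp.pos _) hza hz1 hzp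
  obtain ⟨⟨i', hi'⟩, ⟨j, hj⟩⟩ :=
    exists_pow_eq_pow_mul_of_prime_orderOf hp hm (pow_pos hp.pos _) hzb hz1 hzp
  obtain ⟨d, rfl⟩ := Nat.exists_eq_add_of_le hmk
  -- `b * c` has smaller order than `b` unless the binomial coefficient is prime to `p`
  let t := p ^ d * i * j
  have hbt : b ^ p ^ m = (a ^ t) ^ p ^ m := by
    rw [hj, hi, ← pow_mul, ← pow_mul, ← pow_mul, pow_add]
    congr 1
    simp only [t]; ring
  let c := (a ^ t)⁻¹
  let w := (z ^ t)⁻¹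
  have hcb : c * b = b * c * w := by
    have h1 : SemiconjBy b (a * z) a := by
      rw [SemiconjBy, habz, mul_assoc]
    have h2 := (h1.pow_right t).inv_right
    rw [hzca.symm.mul_pow, mul_inv_rev, (((hzca.pow_pow t t).inv_inv)).eq] at h2
    rw [mul_assoc]; exact h2.symm
  have hwb : Commute w b := (hzcb.pow_left t).inv_left
  have hwa : Commute w a := (hzca.pow_left t).inv_left
  have hwc : Commute w c := (hwa.pow_right t).inv_right
  have hw := mul_pow_of_mul_eq_mul_mul hcb hwb hwc (p ^ m)
  rw [hbt, inv_pow, mul_inv_cancel, one_mul] at hw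
  have hbc : ¬ Commute a (b * c) := fun h => hab (by
    have hac : Commute a c := ((Commute.refl a).pow_right t).inv_right
    simpa using h.mul_right hac.inv_right)
  have hne : w ^ (p ^ m).choose 2 ≠ 1 := fun h1 => by
    rw [h1] at hw
    have hpos : 0 < p ^ m := pow_pos hp.pos _
    have h2 := hmin a (b * c) ha (isOfFinOrder_iff_pow_eq_one.2 ⟨_, hpos, hw⟩) hbc
    have h3 := Nat.le_of_dvd hpos (orderOf_dvd_of_pow_eq_one hw)
    have h4 : p ^ m < p ^ m * p := lt_mul_of_one_lt_right hpos hp.one_lt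
    omega
  have hwp : w ^ p = 1 := by
    simp only [w]
    rw [inv_pow, ← pow_mul, mul_comm, pow_mul, hzp, one_pow, inv_one]
  have hndvd : ¬ p ∣ (p ^ m).choose 2 := by
    rintro ⟨l, hl⟩
    exact hne (by rw [hl, pow_mul, hwp, one_pow])
  obtain ⟨rfl, rfl⟩ := prime_dvd_choose_two hp hndvd
  have hw1 : w ≠ 1 := by simpa using hne
  -- For `d > 0` the exponent `t` is even, so `w` is a power of `z ^ 2 = 1`.
  have hd : d = 0 := by
    by_contra hd
    apply hw1
    obtain ⟨d', rfl⟩ := Nat.exists_eq_succ_of_ne_zero hd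
    simp only [w, t]
    rw [inv_eq_one, show 2 ^ d'.succ * i * j = 2 * (2 ^ d' * i * j) by rw [pow_succ]; ring, pow_mul,
      hzp, one_pow]
  subst hd
  have ha4 : a ^ 4 = 1 := by
    have := pow_orderOf_eq_one a
    rwa [hk] at this
  have hpow (x : G) (hx : x ^ 2 = 1) (i : ℕ) (h : x ^ i ≠ 1) : x ^ i = x := by
    rcases Nat.even_or_odd' i with ⟨l, rfl | rfl⟩
    · rw [pow_mul, hx, one_pow] at h; exact absurd rfl h
    · rw [pow_succ, pow_mul, hx, one_pow, one_mul]
  have haz : z = a ^ 2 := by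
    rw [hi] at hz1 ⊢
    simp only [add_zero, pow_one] at hz1 ⊢
    exact hpow _ (by rw [← pow_mul, ha4]) _ hz1
  have hb2 : b ^ 2 ≠ 1 := fun h => by
    have := Nat.le_of_dvd two_pos (orderOf_dvd_of_pow_eq_one h)
    omega
  have hbz : b ^ 2 = z := by
    rw [pow_one] at hj
    rw [hj] at hb2 ⊢
    exact hpow _ hzp _ hb2
  exact ⟨ha4, haz ▸ hz1, by rw [hbz, haz], by rw [← haz, habz]⟩

theorem exists_isQuaternionPair {G : Type*} [Group G] (hN : FiniteCyclicSubgroupsNormal G)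
    {a b : G} (ha : IsOfFinOrder a) (hb : IsOfFinOrder b) (hab : ¬ Commute a b) :
    ∃ a b : G, IsQuaternionPair a b := by
  let P : ℕ → Prop := fun n => ∃ a b : G, IsOfFinOrder a ∧ IsOfFinOrder b ∧ ¬ Commute a b ∧
    orderOf a + orderOf b = n
  have hP : ∃ n, P n := ⟨_, a, b, ha, hb, hab, rfl⟩
  classical
  obtain ⟨a, b, ha, hb, hab, h⟩ := Nat.find_spec hP
  have hmin : ∀ a' b' : G, IsOfFinOrder a' → IsOfFinOrder b' → ¬ Commute a' b' →
      orderOf a + orderOf b ≤ orderOf a' + orderOf b' := fun a' b' ha' hb' hab' =>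
    h ▸ Nat.find_min' hP ⟨a', b', ha', hb', hab', rfl⟩
  rcases le_total (orderOf b) (orderOf a) with hle | hle
  · exact ⟨a, b, isQuaternionPair_of_minimal hN ha hb hab hle hmin⟩
  · exact ⟨b, a, isQuaternionPair_of_minimal hN hb ha (fun h => hab h.symm) hle
      (by simpa only [add_comm (orderOf b)] using hmin)⟩

/-! ### Bass units, and elements of odd order centralizing a quaternion pair. -/

open Polynomial in
theorem X_pow_orderOf_sub_one_dvd_of_aeval_of_eq_zero {G : Type*} [Group G] {g : G}
    (hg : IsOfFinOrder g) {F : ℤ[X]} (hF : aeval (MonoidAlgebra.of ℤ G g) F = 0) :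
    X ^ orderOf g - 1 ∣ F := by
  classical
  have hN := hg.orderOf_pos
  have hm : (X ^ orderOf g - 1 : ℤ[X]).Monic := monic_X_pow_sub_C 1 hN.ne'
  rw [← modByMonic_eq_zero_iff_dvd hm]
  set R := F %ₘ (X ^ orderOf g - 1) with hR
  have hdeg : R.degree < (orderOf g : ℕ) := by
    have := degree_modByMonic_lt F hm
    rwa [show (X ^ orderOf g - 1 : ℤ[X]).degree = (orderOf g : ℕ) from
      degree_X_pow_sub_C hN 1] at this
  have hR0 : aeval (MonoidAlgebra.of ℤ G g) R = 0 := by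
    have h := congrArg (aeval (MonoidAlgebra.of ℤ G g)) (modByMonic_add_div F (X ^ orderOf g - 1))
    rwa [map_add, map_mul, hF, map_sub, map_pow, aeval_X, ← map_pow, pow_orderOf_eq_one, map_one,
      map_one, sub_self, zero_mul, add_zero] at h
  have hnat : R.natDegree < orderOf g := by
    by_cases h : R = 0
    · rw [h]; simpa using hN
    · exact (natDegree_lt_iff_degree_lt h).2 hdeg
  rw [aeval_eq_sum_range' hnat] at hR0
  ext i
  rw [coeff_zero]
  by_cases hi : i < orderOf g
  · have h := congrArg (fun x => x.coeff (g ^ i)) hR0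
    simp only [MonoidAlgebra.coeff_sum, MonoidAlgebra.of_apply, MonoidAlgebra.coeff_smul,
      MonoidAlgebra.single_pow, one_pow, MonoidAlgebra.coeff_single, MonoidAlgebra.coeff_zero, Finsupp.finsetSum_apply,
      Finsupp.smul_apply, Finsupp.single_apply, Finsupp.coe_zero, Pi.zero_apply] at h
    rw [Finset.sum_eq_single i] at h
    · simpa using h
    · intro j hj hji
      rw [if_neg, smul_zero]
      exact fun h => hji (pow_injOn_Iio_orderOf (Finset.mem_range.1 hj) hi h)
    · simp [hi]
  · exact coeff_eq_zero_of_degree_lt (hdeg.trans_le (by exact_mod_cast not_lt.1 hi))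

theorem sum_range_mul_pow {R : Type*} [CommRing R] (x : R) (k m : ℕ) :
    ∑ i ∈ Finset.range (k * m), x ^ i =
      (∑ i ∈ Finset.range k, x ^ i) * ∑ j ∈ Finset.range m, x ^ (k * j) := by
  induction m with
  | zero => simp
  | succ m ih =>
    rw [mul_add, mul_one, Finset.sum_range_add, ih, Finset.sum_range_succ, mul_add]
    congr 1
    rw [Finset.sum_mul]
    exact Finset.sum_congr rfl fun i _ => by rw [pow_add, mul_comm]

theorem one_add_mul_pow_eq {R : Type*} [CommRing R] {I : R} {N : ℤ} (hI : I * I = N * I) (t : ℤ)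
    (e : ℕ) : ∃ c : ℤ, (1 + t * I) ^ e = 1 + c * I ∧ c * N = (1 + t * N) ^ e - 1 := by
  induction e with
  | zero => exact ⟨0, by simp⟩
  | succ e ih =>
    obtain ⟨c, h1, h2⟩ := ih
    refine ⟨c + t + c * t * N, ?_, ?_⟩
    · rw [pow_succ, h1]
      push_cast
      linear_combination (c * t : R) * hI
    · rw [pow_succ]
      linear_combination (1 + t * N) * h2

/-- With `I` the sum of the powers of `x`, the two geometric sums multiply to `1 + tI`, while they
act on `I` as `k` and `m`. The product is thus `1` plus a multiple of `I`, and `r`, `r'` are the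
corrections that make this multiple vanish. -/
theorem bass_mul_eq_one {R : Type*} [CommRing R] {x : R} {N k m t e : ℕ} {r r' : ℤ} (hN : N ≠ 0)
    (hx : x ^ N = 1) (hkm : k * m = N * t + 1) (hr : r * N = 1 - k ^ e) (hr' : r' * N = 1 - m ^ e) :
    ((∑ i ∈ Finset.range k, x ^ i) ^ e + r * ∑ i ∈ Finset.range N, x ^ i) *
      ((∑ j ∈ Finset.range m, x ^ (k * j)) ^ e + r' * ∑ i ∈ Finset.range N, x ^ i) = 1 := by
  have hxI (l : ℕ) : x ^ l * ∑ i ∈ Finset.range N, x ^ i = ∑ i ∈ Finset.range N, x ^ i := by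
    have h1 : x * ∑ i ∈ Finset.range N, x ^ i = ∑ i ∈ Finset.range N, x ^ i := by
      have := mul_geom_sum x N
      rw [hx, sub_self] at this
      linear_combination this
    induction l with
    | zero => simp
    | succ l ih => rw [pow_succ, mul_assoc, h1, ih]
  have hss := sum_range_mul_pow x k m
  rw [hkm, Finset.sum_range_succ, sum_range_mul_pow, pow_mul, hx, one_pow] at hss
  simp only [pow_mul x N, hx, one_pow, Finset.sum_const, Finset.card_range, nsmul_eq_mul,
    mul_one] at hss
  have hsI : (∑ i ∈ Finset.range k, x ^ i) * ∑ i ∈ Finset.range N, x ^ i =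
      k * ∑ i ∈ Finset.range N, x ^ i := by
    rw [Finset.sum_mul]; simp [hxI]
  have hsI' : (∑ j ∈ Finset.range m, x ^ (k * j)) * ∑ i ∈ Finset.range N, x ^ i =
      m * ∑ i ∈ Finset.range N, x ^ i := by
    rw [Finset.sum_mul]; simp [hxI]
  have hII : (∑ i ∈ Finset.range N, x ^ i) * ∑ i ∈ Finset.range N, x ^ i =
      N * ∑ i ∈ Finset.range N, x ^ i := by
    nth_rewrite 1 [Finset.sum_mul]; simp [hxI]
  generalize (∑ i ∈ Finset.range N, x ^ i) = I at *
  generalize (∑ i ∈ Finset.range k, x ^ i) = s at *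
  generalize (∑ j ∈ Finset.range m, x ^ (k * j)) = s' at *
  have hpow {y : R} {l : ℕ} (h : y * I = l * I) (e : ℕ) : y ^ e * I = l ^ e * I := by
    induction e with
    | zero => simp
    | succ e ih => rw [pow_succ, mul_assoc, h, mul_left_comm, ih]; ring
  obtain ⟨c, hc1, hc2⟩ := one_add_mul_pow_eq (N := N) (by simpa using hII) t e
  -- This is the total coefficient of `I`. It is an integer, so it may be checked after
  -- multiplication by `N`, where `r N` and `r' N` are known.
  have hc : c + r' * k ^ e + r * m ^ e + r * r' * N = 0 := by
    have h0 : (N : ℤ) ≠ 0 := by exact_mod_cast hN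
    apply mul_right_cancel₀ h0
    have hkm' : (k : ℤ) * m = 1 + t * N := by
      rw [add_comm, mul_comm (t : ℤ)]; exact_mod_cast hkm
    rw [← hkm', mul_pow] at hc2
    linear_combination hc2 + (k ^ e : ℤ) * hr' + (m ^ e : ℤ) * hr + r' * N * hr + (1 - k ^ e : ℤ) * hr'
  have hc' : (c + r' * k ^ e + r * m ^ e + r * r' * N : R) = 0 := by exact_mod_cast congrArg (Int.cast (R := R)) hc
  have hss' : s ^ e * s' ^ e = 1 + c * I := by
    rw [← mul_pow, ← hss, ← hc1]
    push_cast; ring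
  linear_combination hss' + (r' : R) * hpow hsI e + (r : R) * hpow hsI' e + (r * r' : R) * hII + hc' * I

open Polynomial in
theorem exists_bass_polynomial_inverse {N k e : ℕ} (hN : 1 < N) (hk : k.Coprime N)
    (he : k ^ e ≡ 1 [MOD N]) :
    ∃ (r : ℤ) (Q : ℤ[X]), X ^ N - 1 ∣
      ((∑ i ∈ Finset.range k, X ^ i) ^ e + (r : ℤ[X]) * ∑ i ∈ Finset.range N, X ^ i) * Q - 1 := by
  obtain ⟨m, -, hm⟩ := Nat.exists_mul_mod_eq_one_of_coprime hk hN
  have hm' : m ^ e ≡ 1 [MOD N] := by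
    have h1 : (k * m) ^ e ≡ 1 ^ e [MOD N] :=
      Nat.ModEq.pow e (by rw [Nat.ModEq, hm, Nat.mod_eq_of_lt hN])
    have h2 : k ^ e * m ^ e ≡ 1 * m ^ e [MOD N] := he.mul_right _
    rw [← mul_pow, one_mul] at h2
    simpa using h2.symm.trans h1
  obtain ⟨r, hr⟩ := (Nat.modEq_iff_dvd.1 he)
  obtain ⟨r', hr'⟩ := (Nat.modEq_iff_dvd.1 hm')
  push_cast at hr hr'
  refine ⟨r, (∑ j ∈ Finset.range m, X ^ (k * j)) ^ e + (r' : ℤ[X]) * ∑ i ∈ Finset.range N, X ^ i, ?_⟩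
  rw [← AdjoinRoot.mk_eq_zero, map_sub, map_one, sub_eq_zero]
  have := bass_mul_eq_one (x := AdjoinRoot.root (X ^ N - 1 : ℤ[X])) (N := N) (k := k) (m := m)
    (t := k * m / N) (e := e) (r := r) (r' := r') (by omega) (by
      have := AdjoinRoot.mk_self (f := (X ^ N - 1 : ℤ[X]))
      rwa [map_sub, map_pow, AdjoinRoot.mk_X, map_one, sub_eq_zero] at this)
    (by rw [← hm]; exact (Nat.div_add_mod _ _).symm) (by linarith) (by linarith)
  simpa using this

theorem SemiconjBy.aeval {R : Type*} [Ring R] {x y z : R} (h : SemiconjBy x y z)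
    (P : Polynomial ℤ) : SemiconjBy x (Polynomial.aeval y P) (Polynomial.aeval z P) := by
  induction P using Polynomial.induction_on' with
  | add p q hp hq => rw [map_add, map_add]; exact hp.add_right hq
  | monomial n r =>
    rw [Polynomial.aeval_monomial, Polynomial.aeval_monomial]
    exact SemiconjBy.mul_right (Algebra.commutes r x).symm (h.pow_right n)

theorem Commute.mul_pow_of_sq {G : Type*} [Group G] {a b c z : G} (ha : a ^ 2 = z) (hb : b ^ 2 = z)
    (hac : Commute a c) (hbc : Commute b c) {m : ℕ} (hm : Odd m) :
    (b * c) ^ m = b * a⁻¹ * (a * c) ^ m := by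
  obtain ⟨l, rfl⟩ := hm
  have h (x : G) : x ^ (2 * l + 1) = x * (x ^ 2) ^ l := by rw [pow_succ', pow_mul]
  rw [hbc.mul_pow, hac.mul_pow, h a, h b, ha, hb]
  group

-- Monomials of even degree cancel because `z² = 1`; in odd degree `(bc) ^ n = b a⁻¹ (ac) ^ n`
-- because `a² = b²`.
open Polynomial in
theorem aeval_sub_aeval_eq_mul {G : Type*} [Group G] {a b c z : G} (ha : a ^ 2 = z)
    (hb : b ^ 2 = z) (hz : z ^ 2 = 1) (hac : Commute a c) (hbc : Commute b c) (hzc : Commute z c)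
    (P : ℤ[X]) :
    aeval (MonoidAlgebra.of ℤ G (b * c)) P - aeval (MonoidAlgebra.of ℤ G (z * (b * c))) P =
      MonoidAlgebra.of ℤ G (b * a⁻¹) * (aeval (MonoidAlgebra.of ℤ G (a * c)) P -
        aeval (MonoidAlgebra.of ℤ G (z * (a * c))) P) := by
  have hzb : Commute z b := by rw [← hb]; exact (Commute.refl b).pow_left 2
  have hza : Commute z a := by rw [← ha]; exact (Commute.refl a).pow_left 2
  induction P using Polynomial.induction_on' with
  | add p q hp hq =>
    simp only [map_add]
    rw [add_sub_add_comm, hp, hq, ← mul_add, add_sub_add_comm]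
  | monomial n r =>
    simp only [aeval_monomial, ← map_pow, (hza.mul_right hzc).mul_pow, (hzb.mul_right hzc).mul_pow,
      ← mul_sub]
    rw [← mul_assoc, ← Algebra.commutes r (MonoidAlgebra.of ℤ G (b * a⁻¹)), mul_assoc]
    congr 1
    rcases Nat.even_or_odd n with hn | hn
    · obtain ⟨l, rfl⟩ := hn.two_dvd
      simp [pow_mul, hz]
    · have hzn : z ^ n = z := by
        obtain ⟨l, rfl⟩ := hn
        rw [pow_succ, pow_mul, hz, one_pow, one_mul]
      rw [hzn, mul_sub, ← map_mul, ← map_mul, Commute.mul_pow_of_sq ha hb hac hbc hn]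
      congr 2
      rw [← mul_assoc z, (hzb.mul_right hza.inv_right).eq, mul_assoc]

theorem geom_sum_inverse {R : Type*} [Ring R] {x y : R} (hxy : x * y = 1) (hyx : y * x = 1)
    (l : ℕ) : ∑ i ∈ Finset.range (l + 1), y ^ i = y ^ l * ∑ i ∈ Finset.range (l + 1), x ^ i := by
  have hc : Commute y x := hyx.trans hxy.symm
  rw [Finset.mul_sum, ← Finset.sum_range_reflect]
  refine Finset.sum_congr rfl fun i hi => ?_
  have hi' : i ≤ l := Nat.lt_succ_iff.1 (Finset.mem_range.1 hi)
  rw [show l + 1 - 1 - i = l - i by omega]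
  nth_rewrite 2 [← Nat.sub_add_cancel hi']
  rw [pow_add, mul_assoc, ← hc.mul_pow, hyx, one_pow, mul_one]

open Polynomial in
theorem groupRingStar_aeval {G : Type*} [Group G] (g : G) (P : ℤ[X]) :
    groupRingStar (aeval (MonoidAlgebra.of ℤ G g) P) = aeval (MonoidAlgebra.of ℤ G g⁻¹) P := by
  induction P using Polynomial.induction_on' with
  | add p q hp hq => rw [map_add, map_add, hp, hq, map_add]
  | monomial n r =>
    simp only [aeval_monomial, ← map_pow]
    rw [← Algebra.smul_def, map_smul, groupRingStar_of, inv_pow, Algebra.smul_def]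

open Polynomial in
theorem exists_mem_symmetricUnits_eq_aeval {G : Type*} [Group G] {g : G} {n e : ℕ} {r : ℤ}
    {Q : ℤ[X]} (hn : 0 < n) (hg : g ^ (4 * n) = 1) (hQ : (X ^ (4 * n) - 1 : ℤ[X]) ∣
      ((∑ i ∈ Finset.range (2 * n + 1), X ^ i) ^ (2 * e) +
        (r : ℤ[X]) * ∑ i ∈ Finset.range (4 * n), X ^ i) * Q - 1) :
    ∃ u ∈ symmetricUnits G, (u : MonoidAlgebra ℤ G) = aeval (MonoidAlgebra.of ℤ G g)
      ((∑ i ∈ Finset.range (2 * n + 1), X ^ i) ^ (2 * e) +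
        (r : ℤ[X]) * ∑ i ∈ Finset.range (4 * n), X ^ i) := by
  set P : ℤ[X] := (∑ i ∈ Finset.range (2 * n + 1), X ^ i) ^ (2 * e) +
        (r : ℤ[X]) * ∑ i ∈ Finset.range (4 * n), X ^ i with hP
  have h1 : aeval (MonoidAlgebra.of ℤ G g) (P * Q) = 1 := by
    obtain ⟨F, hF⟩ := hQ
    rw [eq_add_of_sub_eq hF, map_add, map_mul, map_sub, map_pow, aeval_X, ← map_pow, hg, map_one,
      map_one, sub_self, zero_mul, zero_add]
  let u : (MonoidAlgebra ℤ G)ˣ := ⟨aeval (MonoidAlgebra.of ℤ G g) P,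
    aeval (MonoidAlgebra.of ℤ G g) Q, by rw [← map_mul, h1], by rw [← map_mul, mul_comm, h1]⟩
  refine ⟨u, ?_, rfl⟩
  change groupRingStar (aeval (MonoidAlgebra.of ℤ G g) P) = aeval (MonoidAlgebra.of ℤ G g) P
  rw [groupRingStar_aeval, hP]
  simp only [map_add, map_mul, map_pow, map_sum, aeval_X, map_intCast]
  have hxy : MonoidAlgebra.of ℤ G g * MonoidAlgebra.of ℤ G g⁻¹ = 1 := by
    rw [← map_mul, mul_inv_cancel, map_one]
  have hyx : MonoidAlgebra.of ℤ G g⁻¹ * MonoidAlgebra.of ℤ G g = 1 := by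
    rw [← map_mul, inv_mul_cancel, map_one]
  have hy : MonoidAlgebra.of ℤ G g⁻¹ ^ (4 * n) = 1 := by
    rw [← map_pow, inv_pow, hg, inv_one, map_one]
  have hx : MonoidAlgebra.of ℤ G g ^ (4 * n) = 1 := by rw [← map_pow, hg, map_one]
  generalize MonoidAlgebra.of ℤ G g⁻¹ = y at *
  generalize MonoidAlgebra.of ℤ G g = x at *
  have hc : Commute y x := hyx.trans hxy.symm
  obtain ⟨l, hl⟩ : ∃ l, 4 * n = l + 1 := ⟨4 * n - 1, by omega⟩
  congr 1
  -- Inverting `g` multiplies the sum of length `2n + 1` by `g ^ (-2n)`; the power `2e` turns this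
  -- factor into `g ^ (-4ne) = 1`.
  · rw [geom_sum_inverse hxy hyx,
      ((Commute.sum_right _ _ _ fun i _ => hc.pow_right i).pow_left _).mul_pow, ← pow_mul,
      show 2 * n * (2 * e) = 4 * n * e by ring, pow_mul, hy, one_pow, one_mul]
  · have hyl : y ^ l = x := by
      rw [hl, pow_succ] at hy
      rw [← mul_one (y ^ l), ← hyx, ← mul_assoc, hy, one_mul]
    have hgs := mul_geom_sum x (4 * n)
    rw [hx, sub_self, sub_mul, one_mul, sub_eq_zero, hl] at hgs
    rw [hl, geom_sum_inverse hxy hyx, hyl, hgs]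

theorem complex_pow_four_eq_one {w : ℂ} (h1 : ‖w‖ = 1) (h2 : ‖w + 1‖ = ‖w - 1‖) : w ^ 4 = 1 := by
  have h3 : w.re = 0 := by
    have := congrArg (· ^ 2) h2
    simp only [← Complex.normSq_eq_norm_sq, Complex.normSq_apply] at this
    simp at this
    linarith
  have h4 : w.im * w.im = 1 := by
    have := congrArg (· ^ 2) h1
    simp only [← Complex.normSq_eq_norm_sq, Complex.normSq_apply] at this
    simpa [h3] using this
  have h5 : w ^ 2 = -1 := by
    rw [pow_two]
    apply Complex.ext <;> simp [h3, h4]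
  rw [show w ^ 4 = (w ^ 2) ^ 2 by ring, h5]
  norm_num

-- Evaluation at a primitive `4n`-th root of unity `w` gives `P(w) = P(-w)`. The geometric sum at
-- `w` is `-(w + 1)/(w - 1)` and at `-w` the ratio is inverted, so `|w + 1| = |w - 1|`. Then `w` is
-- purely imaginary of modulus 1, `w ^ 4 = 1`, and `4n` divides `4`.
open Polynomial in
theorem eq_one_of_bass_dvd {n e : ℕ} {r : ℤ} (hn : 0 < n) (he : e ≠ 0)
    {P : ℤ[X]} (hP : P = ((∑ i ∈ Finset.range (2 * n + 1), X ^ i) ^ (2 * e) +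
      (r : ℤ[X]) * ∑ i ∈ Finset.range (4 * n), X ^ i))
    (h : X ^ (4 * n) - 1 ∣ P - P.comp (X ^ (2 * n + 1))) : n = 1 := by
  obtain ⟨w, hw⟩ : ∃ w : ℂ, IsPrimitiveRoot w (4 * n) :=
    ⟨_, Complex.isPrimitiveRoot_exp _ (by omega)⟩
  have hw1 : w ^ (4 * n) = 1 := hw.pow_eq_one
  have hw2 : w ^ (2 * n) = -1 := by
    have h1 : (w ^ (2 * n)) ^ 2 = 1 := by rw [← pow_mul, ← hw1]; ring
    exact (sq_eq_sq_iff_eq_or_eq_neg.1 (h1.trans (one_pow 2).symm)).resolve_left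
      (hw.pow_ne_one_of_pos_of_lt (by omega) (by omega))
  have hne : w ^ 2 ≠ 1 := hw.pow_ne_one_of_pos_of_lt (by omega) (by omega)
  have hne1 : w ≠ 1 := fun h => hne (by rw [h, one_pow])
  have hne2 : -w ≠ 1 := fun h => hne (by rw [← neg_sq, h, one_pow])
  have hev : aeval w P = aeval (-w) P := by
    obtain ⟨F, hF⟩ := h
    have := congrArg (aeval w) hF
    rw [map_mul, map_sub, map_sub, map_pow, aeval_X, hw1, map_one, sub_self, zero_mul,
      aeval_comp, map_pow, aeval_X, pow_succ, hw2, neg_one_mul, sub_eq_zero] at this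
    exact this
  have hval (v : ℂ) (hv : v ^ (4 * n) = 1) (hv2 : v ^ (2 * n) = -1) (hv1 : v ≠ 1) :
      aeval v P * (v - 1) ^ (2 * e) = (v + 1) ^ (2 * e) := by
    have hs : ∑ i ∈ Finset.range (4 * n), v ^ i = 0 := by
      have := mul_geom_sum v (4 * n)
      rw [hv, sub_self] at this
      exact (mul_eq_zero.1 this).resolve_left (sub_ne_zero.2 hv1)
    rw [hP]
    simp only [map_add, map_mul, map_pow, map_sum, aeval_X, map_intCast, hs, mul_zero, add_zero]
    rw [← mul_pow, geom_sum_mul, pow_succ, hv2, pow_mul, pow_mul]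
    congr 1
    ring
  have hv1 := hval w hw1 hw2 hne1
  have hv2 := hval (-w) (by rw [Even.neg_pow ⟨2 * n, by ring⟩, hw1])
    (by rw [Even.neg_pow ⟨n, by ring⟩, hw2]) hne2
  rw [← hev, pow_mul (-w - 1), pow_mul (-w + 1), show (-w - 1) ^ 2 = (w + 1) ^ 2 by ring,
    show (-w + 1) ^ 2 = (w - 1) ^ 2 by ring, ← pow_mul, ← pow_mul] at hv2
  have hpow : (w + 1) ^ (2 * e + 2 * e) = (w - 1) ^ (2 * e + 2 * e) := by
    rw [pow_add, pow_add]
    linear_combination (w - 1) ^ (2 * e) * hv2 - (w + 1) ^ (2 * e) * hv1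
  have hnorm : ‖w + 1‖ = ‖w - 1‖ := by
    have := congrArg norm hpow
    rw [norm_pow, norm_pow] at this
    exact (pow_left_inj₀ (norm_nonneg _) (norm_nonneg _) (by omega)).1 this
  have h4 := complex_pow_four_eq_one (Complex.norm_eq_one_of_pow_eq_one hw1 (by omega)) hnorm
  have := Nat.le_of_dvd (by norm_num) ((hw.pow_eq_one_iff_dvd 4).1 h4)
  omega

-- Let `D = P(ac) - P(zac)` for the Bass polynomial `P`. The symmetric units involved commute, so
-- `D` commutes with `b a⁻¹ D`; but conjugation by `b` exchanges `ac` and `zac`, so `b a⁻¹`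
-- anticommutes with `D`. Hence `D² = 0`, and `D = 0` since `D` is symmetric. As `zac = (ac) ^ (2n +
-- 1)`, this is the divisibility required by `eq_one_of_bass_dvd`.
open Polynomial in
theorem eq_one_of_isQuaternionPair {G : Type*} [Group G]
    (hS : ∀ x ∈ symmetricUnits G, ∀ y ∈ symmetricUnits G, x * y = y * x)
    {a b c : G} (hab : IsQuaternionPair a b) (hac : Commute a c) (hbc : Commute b c)
    (hodd : Odd (orderOf c)) : c = 1 := by
  obtain ⟨n, hcn⟩ : ∃ n, orderOf c = n := ⟨_, rfl⟩
  rw [hcn] at hodd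
  have hn : 0 < n := hodd.pos
  obtain ⟨z, hz⟩ : ∃ z, z = a ^ 2 := ⟨_, rfl⟩
  have hbz : b ^ 2 = z := by rw [hz, hab.sq_eq]
  have hz2 : z ^ 2 = 1 := by rw [hz, ← pow_mul, hab.pow_four]
  have hzc : Commute z c := by rw [hz]; exact hac.pow_left 2
  have hzb : Commute z b := by rw [← hbz]; exact (Commute.refl b).pow_left 2
  have hza : Commute z a := by rw [hz]; exact (Commute.refl a).pow_left 2
  have hc1 : c ^ n = 1 := by rw [← hcn, pow_orderOf_eq_one]
  have hordera : orderOf a = 4 := by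
    have := orderOf_eq_prime_pow (p := 2) (n := 1) (x := a) (by simpa using hab.sq_ne_one)
      (by simpa using hab.pow_four)
    simpa using this
  have horder : orderOf (a * c) = 4 * n := by
    rw [hac.orderOf_mul_eq_mul_orderOf_of_coprime, hordera, hcn]
    rw [hordera, hcn, show 4 = 2 ^ 2 by norm_num]
    exact Nat.Coprime.pow_left 2 (Nat.coprime_two_left.2 hodd)
  have hg2 : (a * c) ^ (2 * n + 1) = z * (a * c) := by
    obtain ⟨l, rfl⟩ := hodd
    rw [pow_succ, hac.mul_pow, pow_mul, ← hz, pow_succ z, pow_mul, hz2, one_pow, one_mul,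
      mul_comm 2, pow_mul c, hc1, one_pow, mul_one]
  have hz4 : z ^ (4 * n) = 1 := by
    rw [show 4 * n = 2 * (2 * n) by ring, pow_mul, hz2, one_pow]
  have hc4 : c ^ (4 * n) = 1 := by rw [mul_comm, pow_mul, hc1, one_pow]
  have hg : (a * c) ^ (4 * n) = 1 := by rw [← horder, pow_orderOf_eq_one]
  have hzg : (z * (a * c)) ^ (4 * n) = 1 := by
    rw [(hza.mul_right hzc).mul_pow, hz4, hg, one_mul]
  have hh : (b * c) ^ (4 * n) = 1 := by
    rw [hbc.mul_pow, hc4, pow_mul, show b ^ 4 = (b ^ 2) ^ 2 by rw [← pow_mul], hbz, hz2, one_pow,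
      one_mul]
  have hzh : (z * (b * c)) ^ (4 * n) = 1 := by
    rw [(hzb.mul_right hzc).mul_pow, hz4, hh, one_mul]
  have hcop : (2 * n + 1).Coprime (4 * n) := by
    have h2 : (2 * n + 1).Coprime 2 := (Nat.coprime_two_right).2 ⟨n, rfl⟩
    have h3 : (2 * n + 1).Coprime n := by simp
    exact (show 4 * n = 2 * 2 * n by ring) ▸ (h2.mul_right h2).mul_right h3
  -- The totient gives the congruence needed for a Bass unit; doubling the exponent makes the unit
  -- symmetric.
  let e := Nat.totient (4 * n)
  have he0 : e ≠ 0 := (Nat.totient_pos.2 (by omega)).ne'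
  have he : (2 * n + 1) ^ (2 * e) ≡ 1 [MOD 4 * n] := by
    rw [mul_comm 2 e, pow_mul]
    simpa using (Nat.ModEq.pow_totient hcop).pow 2
  obtain ⟨r, Q, hQ⟩ := exists_bass_polynomial_inverse (by omega) hcop he
  have hunit {g : G} (hg : g ^ (4 * n) = 1) := exists_mem_symmetricUnits_eq_aeval hn hg hQ
  obtain ⟨P, hP⟩ : ∃ P, P = ((∑ i ∈ Finset.range (2 * n + 1), (X : ℤ[X]) ^ i) ^ (2 * e) +
      (r : ℤ[X]) * ∑ i ∈ Finset.range (4 * n), X ^ i) := ⟨_, rfl⟩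
  rw [← hP] at hunit
  have hcomm {g h : G} (hg : g ^ (4 * n) = 1) (hh : h ^ (4 * n) = 1) :
      Commute (aeval (MonoidAlgebra.of ℤ G g) P) (aeval (MonoidAlgebra.of ℤ G h) P) := by
    obtain ⟨u, hu, hu'⟩ := hunit hg
    obtain ⟨v, hv, hv'⟩ := hunit hh
    rw [← hu', ← hv']
    exact congrArg Units.val (hS u hu v hv)
  have hstar {g : G} (hg : g ^ (4 * n) = 1) : groupRingStar (aeval (MonoidAlgebra.of ℤ G g) P) =
      aeval (MonoidAlgebra.of ℤ G g) P := by
    obtain ⟨u, hu, hu'⟩ := hunit hg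
    rw [← hu']
    exact hu
  obtain ⟨D, hD⟩ : ∃ D, D = aeval (MonoidAlgebra.of ℤ G (a * c)) P -
    aeval (MonoidAlgebra.of ℤ G (z * (a * c))) P := ⟨_, rfl⟩
  have hE := aeval_sub_aeval_eq_mul hz.symm hbz hz2 hac hbc hzc P
  rw [← hD] at hE
  have hDE : Commute D (MonoidAlgebra.of ℤ G (b * a⁻¹) * D) := by
    rw [← hE, hD]
    exact ((hcomm hg hh).sub_right (hcomm hg hzh)).sub_left
      ((hcomm hzg hh).sub_right (hcomm hzg hzh))
  have hconj {x g h : G} (hx : SemiconjBy x g h) : SemiconjBy (MonoidAlgebra.of ℤ G x)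
      (aeval (MonoidAlgebra.of ℤ G g) P) (aeval (MonoidAlgebra.of ℤ G h) P) :=
    (hx.map (MonoidAlgebra.of ℤ G)).aeval P
  have hDa : SemiconjBy (MonoidAlgebra.of ℤ G a⁻¹) D D := by
    have h1 : Commute a⁻¹ (a * c) := ((Commute.refl a).mul_right hac).inv_left
    have h2 : Commute a⁻¹ (z * (a * c)) := hza.symm.inv_left.mul_right h1
    rw [hD]
    exact (hconj h1).sub_right (hconj h2)
  have hbab : SemiconjBy b (z * (a * c)) (a * c) := by
    have h : SemiconjBy b (z * a) a := by
      rw [SemiconjBy, hab.mul_eq, ← hz, mul_assoc, hza.eq]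
    rw [← mul_assoc]
    exact h.mul_right hbc
  have hbab' : SemiconjBy b (a * c) (z * (a * c)) := by
    have h : SemiconjBy b z z := hzb.symm
    have := h.mul_right hbab
    rwa [← mul_assoc z z, ← pow_two, hz2, one_mul] at this
  have hDb : SemiconjBy (MonoidAlgebra.of ℤ G b) D (-D) := by
    rw [hD, neg_sub]
    exact (hconj hbab').sub_right (hconj hbab)
  have hDD : D * D = 0 := by
    have h1 : SemiconjBy (MonoidAlgebra.of ℤ G (b * a⁻¹)) D (-D) := by
      rw [map_mul]
      exact hDb.mul_left hDa
    have h2 : MonoidAlgebra.of ℤ G (b * a⁻¹) * (D * D) = 0 := by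
      have h3 : MonoidAlgebra.of ℤ G (b * a⁻¹) * (D * D) =
          -(MonoidAlgebra.of ℤ G (b * a⁻¹) * (D * D)) := by
        have h4 : D * MonoidAlgebra.of ℤ G (b * a⁻¹) = -(MonoidAlgebra.of ℤ G (b * a⁻¹) * D) := by
          rw [h1.eq, neg_mul, neg_neg]
        nth_rewrite 1 [← mul_assoc]
        rw [← hDE.eq, ← mul_assoc, h4, neg_mul, mul_assoc]
      ext g
      have h4 := congrArg (fun x => x.coeff g) h3
      simp only [MonoidAlgebra.coeff_neg, Finsupp.neg_apply] at h4
      simp only [MonoidAlgebra.coeff_zero, Finsupp.coe_zero, Pi.zero_apply]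
      omega
    calc D * D = MonoidAlgebra.of ℤ G (b * a⁻¹)⁻¹ *
          (MonoidAlgebra.of ℤ G (b * a⁻¹) * (D * D)) := by
            rw [← mul_assoc, ← map_mul, inv_mul_cancel, map_one, one_mul]
      _ = 0 := by rw [h2, mul_zero]
  have hD0 : D = 0 := by
    apply eq_zero_of_groupRingStar_mul_self
    rwa [show groupRingStar D = D by rw [hD, map_sub, hstar hg, hstar hzg]]
  have hdvd : X ^ (4 * n) - 1 ∣ P - P.comp (X ^ (2 * n + 1)) := by
    rw [← horder]
    apply X_pow_orderOf_sub_one_dvd_of_aeval_of_eq_zero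
    · exact isOfFinOrder_iff_pow_eq_one.2 ⟨4 * n, by omega, hg⟩
    · rw [map_sub, aeval_comp, map_pow, aeval_X, ← map_pow, hg2, ← hD, hD0]
  have hn1 := eq_one_of_bass_dvd hn he0 hP hdvd
  rw [hn1, orderOf_eq_one_iff] at hcn
  exact hcn

/-! ### Necessity of the torsion conditions. -/

theorem exists_torsionConditions_of_symmetricUnits_commute {G : Type*} [Group G]
    (hS : ∀ x ∈ symmetricUnits G, ∀ y ∈ symmetricUnits G, x * y = y * x) :
    ∃ T : Subgroup G, TorsionConditions T := by
  have hN : FiniteCyclicSubgroupsNormal G :=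
    fun a x ha => conj_mem_zpowers_of_symmetricUnits_commute hS ha x
  let T : Subgroup G :=
    { carrier := torsionElements G
      mul_mem' := fun ha hb => hN.isOfFinOrder_mul ha hb
      one_mem' := IsOfFinOrder.one
      inv_mem' := fun ha => IsOfFinOrder.inv ha }
  have hnormal : ∀ H : Subgroup G, H ≤ T → H.Normal := fun H hH => ⟨fun n hn g => by
    have := hN n g⁻¹ (hH hn)
    rw [inv_inv] at this
    exact (Subgroup.zpowers_le.2 hn) this⟩
  refine ⟨T, rfl, hnormal, ?_⟩
  by_cases hab : ∀ x y : T, x * y = y * x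
  · exact Or.inl hab
  push Not at hab
  refine Or.inr ⟨⟨hab, fun H => ?_⟩, ?_⟩
  · have h := hnormal (H.map T.subtype) (Subgroup.map_subtype_le H)
    have := h.comap T.subtype
    rwa [Subgroup.comap_map_eq_self_of_injective T.subtype_injective] at this
  · obtain ⟨x, y, hxy⟩ := hab
    obtain ⟨a, b, h⟩ := exists_isQuaternionPair hN x.2 y.2 (fun h => hxy (Subtype.ext h))
    have ha : IsOfFinOrder a := isOfFinOrder_iff_pow_eq_one.2 ⟨4, by norm_num, h.pow_four⟩
    have hb : IsOfFinOrder b := isOfFinOrder_iff_pow_eq_one.2 ⟨4, by norm_num, by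
      rw [show b ^ 4 = (b ^ 2) ^ 2 by rw [← pow_mul], h.sq_eq, ← pow_mul, h.pow_four]⟩
    intro t
    have ht : IsOfFinOrder (t : G) := t.2
    obtain ⟨k, m, hm, hk⟩ := Nat.exists_eq_two_pow_mul_odd ht.orderOf_pos.ne'
    have horder : orderOf ((t : G) ^ 2 ^ k) = m := by
      rw [orderOf_pow_of_dvd (by positivity) (hk ▸ dvd_mul_right _ _), hk,
        Nat.mul_div_cancel_left _ (by positivity)]
    -- The commutator lies in two cyclic groups of coprime orders, the second being odd, so it is
    -- trivial.
    have hcomm {d : G} (hd : IsOfFinOrder d) (hd4 : d ^ 4 = 1) : Commute d ((t : G) ^ 2 ^ k) := by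
      obtain ⟨h1, h2⟩ := commutator_mem_zpowers hN hd (ht.pow (n := 2 ^ k))
      have hcop : (orderOf d).Coprime (orderOf ((t : G) ^ 2 ^ k)) := by
        rw [horder]
        refine Nat.Coprime.coprime_dvd_left (orderOf_dvd_of_pow_eq_one hd4) ?_
        exact Nat.Coprime.pow_left 2 (Nat.coprime_two_left.2 hm)
      have h3 : d⁻¹ * ((t : G) ^ 2 ^ k)⁻¹ * d * (t : G) ^ 2 ^ k = 1 := by
        rw [← orderOf_eq_one_iff]
        exact Nat.eq_one_of_dvd_coprimes hcop (orderOf_dvd_of_mem_zpowers h1)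
          (orderOf_dvd_of_mem_zpowers h2)
      have h4 : d⁻¹ * ((t : G) ^ 2 ^ k)⁻¹ * d * (t : G) ^ 2 ^ k =
        ((t : G) ^ 2 ^ k * d)⁻¹ * (d * (t : G) ^ 2 ^ k) := by group
      rw [h4, inv_mul_eq_one] at h3
      exact h3.symm
    refine ⟨k, Subtype.ext ?_⟩
    exact eq_one_of_isQuaternionPair hS h (hcomm ha h.pow_four) (hcomm hb (by
      rw [show b ^ 4 = (b ^ 2) ^ 2 by rw [← pow_mul], h.sq_eq, ← pow_mul, h.pow_four]))
      (horder ▸ hm)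

/-! ### Exponent four in the hamiltonian case. -/

theorem FiniteCyclicSubgroupsNormal.conj_eq_or_eq_inv {G : Type*} [Group G]
    (hN : FiniteCyclicSubgroupsNormal G) {s : G} (hs : s ^ 4 = 1) (t : G) :
    t⁻¹ * s * t = s ∨ t⁻¹ * s * t = s⁻¹ := by
  have hfin : IsOfFinOrder s := isOfFinOrder_iff_pow_eq_one.2 ⟨4, by norm_num, hs⟩
  obtain ⟨i, hi⟩ := hfin.mem_powers_iff_mem_zpowers.2 (hN s t hfin)
  simp only at hi
  have hone (x : G) (h : t⁻¹ * x * t = 1) : x = 1 := by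
    calc x = t * (t⁻¹ * x * t) * t⁻¹ := by group
      _ = 1 := by rw [h]; group
  rw [← Nat.mod_add_div i 4, pow_add, pow_mul, hs, one_pow, mul_one] at hi
  have h4 : i % 4 < 4 := Nat.mod_lt _ (by norm_num)
  interval_cases h : i % 4
  · left
    rw [pow_zero] at hi
    rw [← hi, hone s hi.symm]
  · left
    rw [← hi, pow_one]
  · left
    have h1 : t⁻¹ * s ^ 2 * t = 1 := by
      calc t⁻¹ * s ^ 2 * t = (t⁻¹ * s * t) ^ 2 := by simp only [pow_two]; group
        _ = 1 := by rw [← hi, ← pow_mul, hs]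
    rw [hone _ h1] at hi
    rw [← hi, hone s hi.symm]
  · right
    rw [← hi, eq_inv_iff_mul_eq_one, ← pow_succ, hs]

theorem mul_pow_four_of_conj_eq_or_eq_inv {G : Type*} [Group G] {t q : G} (hq : q ^ 4 = 1)
    (h : t⁻¹ * q * t = q ∨ t⁻¹ * q * t = q⁻¹) : (t * q) ^ 4 = t ^ 4 := by
  rcases h with h | h
  · have hc : Commute t q := by
      rw [mul_assoc, inv_mul_eq_iff_eq_mul] at h
      exact h.symm
    rw [hc.mul_pow, hq, mul_one]
  · have h1 : (t * q) ^ 2 = t ^ 2 := by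
      calc (t * q) ^ 2 = t ^ 2 * (t⁻¹ * q * t) * q := by simp only [pow_two]; group
        _ = t ^ 2 := by rw [h]; group
    rw [show 4 = 2 * 2 from rfl, pow_mul, h1, ← pow_mul]

theorem IsQuaternionPair.pow_four_right {G : Type*} [Group G] {a b : G}
    (h : IsQuaternionPair a b) : b ^ 4 = 1 := by
  rw [show b ^ 4 = (b ^ 2) ^ 2 by rw [← pow_mul], h.sq_eq, ← pow_mul, h.pow_four]

theorem IsQuaternionPair.inv_mul_mul {G : Type*} [Group G] {a b : G}
    (h : IsQuaternionPair a b) : b⁻¹ * a * b = a⁻¹ := by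
  rw [mul_assoc, h.mul_eq, mul_assoc, inv_mul_cancel_left, eq_inv_iff_mul_eq_one, ← h.pow_four]
  group

theorem IsQuaternionPair.inv_mul_mul' {G : Type*} [Group G] {a b : G}
    (h : IsQuaternionPair a b) : a⁻¹ * b * a = b⁻¹ := by
  have h1 : b * a = a * b * a ^ 2 := by
    rw [h.mul_eq, mul_assoc _ (a ^ 2), ← pow_add, h.pow_four, mul_one]
  rw [mul_assoc, h1, mul_assoc, inv_mul_cancel_left, eq_inv_iff_mul_eq_one, ← h.sq_eq,
    ← h.pow_four_right]
  group

/-- Once `x ^ 4 = 1` is known by induction, conjugation by `a` sends `bx` to `b⁻¹x`, which must be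
`bx` or its inverse. The first would give `b² = 1`; the second gives `x = x⁻¹`. -/
theorem IsQuaternionPair.sq_eq_one_of_commute {G : Type*} [Group G]
    (hN : FiniteCyclicSubgroupsNormal G) {a b : G} (h : IsQuaternionPair a b) (k : ℕ) {x : G}
    (ha : Commute a x) (hb : Commute b x) (hx : x ^ 2 ^ k = 1) : x ^ 2 = 1 := by
  induction k generalizing x with
  | zero => rw [pow_zero, pow_one] at hx; rw [hx, one_pow]
  | succ k ih =>
    have hx4 : x ^ 4 = 1 := by
      have := ih (ha.pow_right 2) (hb.pow_right 2) (by rw [← pow_mul, ← pow_succ', hx])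
      rwa [← pow_mul] at this
    have hbx : (b * x) ^ 4 = 1 := by rw [hb.mul_pow, h.pow_four_right, hx4, one_mul]
    have hconj : a⁻¹ * (b * x) * a = b⁻¹ * x := by
      rw [mul_assoc, mul_assoc b, ha.symm.eq, ← mul_assoc b, ← mul_assoc a⁻¹, ← mul_assoc a⁻¹,
        h.inv_mul_mul']
    rcases hN.conj_eq_or_eq_inv hbx a with h1 | h1
    · rw [hconj, mul_left_inj, inv_eq_iff_mul_eq_one, ← pow_two, h.sq_eq] at h1
      exact absurd h1 h.sq_ne_one
    · rw [hconj, hb.eq, mul_inv_rev, mul_right_inj] at h1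
      rw [pow_two, ← eq_inv_iff_mul_eq_one]
      exact h1

/-- Multiplying `t` by `a` or `b` where needed moves it into the centralizer of the pair without
changing its fourth power. -/
theorem IsQuaternionPair.pow_four_eq_one {G : Type*} [Group G]
    (hN : FiniteCyclicSubgroupsNormal G) {a b : G} (h : IsQuaternionPair a b) {k : ℕ} {t : G}
    (ht : t ^ 2 ^ k = 1) : t ^ 4 = 1 := by
  have hfix {s x : G} (h : x⁻¹ * s * x = s) : Commute s x := by
    rwa [mul_assoc, inv_mul_eq_iff_eq_mul] at h
  obtain ⟨x, hx, hbx⟩ : ∃ x : G, x ^ 4 = t ^ 4 ∧ Commute b x := by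
    rcases hN.conj_eq_or_eq_inv h.pow_four_right t with h1 | h1
    · exact ⟨t, rfl, hfix h1⟩
    · refine ⟨t * a, mul_pow_four_of_conj_eq_or_eq_inv h.pow_four
        (hN.conj_eq_or_eq_inv h.pow_four t), hfix ?_⟩
      calc (t * a)⁻¹ * b * (t * a) = a⁻¹ * (t⁻¹ * b * t) * a := by group
        _ = (a⁻¹ * b * a)⁻¹ := by rw [h1]; group
        _ = b := by rw [h.inv_mul_mul', inv_inv]
  obtain ⟨y, hy, hby, hay⟩ : ∃ y : G, y ^ 4 = t ^ 4 ∧ Commute b y ∧ Commute a y := by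
    rcases hN.conj_eq_or_eq_inv h.pow_four x with h1 | h1
    · exact ⟨x, hx, hbx, hfix h1⟩
    · refine ⟨x * b, ?_, hbx.mul_right (Commute.refl b), hfix ?_⟩
      · rw [mul_pow_four_of_conj_eq_or_eq_inv h.pow_four_right
          (hN.conj_eq_or_eq_inv h.pow_four_right x), hx]
      calc (x * b)⁻¹ * a * (x * b) = b⁻¹ * (x⁻¹ * a * x) * b := by group
        _ = (b⁻¹ * a * b)⁻¹ := by rw [h1]; group
        _ = a := by rw [h.inv_mul_mul, inv_inv]
  have hyk : y ^ 2 ^ (k + 2) = 1 := by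
    rw [pow_add, mul_comm, pow_mul, show 2 ^ 2 = 4 from rfl, hy, ← pow_mul, mul_comm, pow_mul, ht,
      one_pow]
  rw [← hy, show 4 = 2 * 2 from rfl, pow_mul, h.sq_eq_one_of_commute hN _ hay hby hyk, one_pow]

theorem TorsionConditions.mem_iff {G : Type*} [Group G] {T : Subgroup G} (hT : TorsionConditions T)
    {g : G} : g ∈ T ↔ IsOfFinOrder g := by
  rw [← SetLike.mem_coe, hT.coe_eq]
  rfl

theorem TorsionConditions.finiteCyclicSubgroupsNormal {G : Type*} [Group G] {T : Subgroup G}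
    (hT : TorsionConditions T) : FiniteCyclicSubgroupsNormal G := fun a x ha => by
  have h := hT.normal_of_le (Subgroup.zpowers a) (Subgroup.zpowers_le.2 (hT.mem_iff.2 ha))
  have := h.conj_mem a (Subgroup.mem_zpowers a) x⁻¹
  rwa [inv_inv] at this

theorem TorsionConditions.abelian_or_pow_four {G : Type*} [Group G] {T : Subgroup G}
    (hT : TorsionConditions T) :
    (∀ x ∈ T, ∀ y ∈ T, x * y = y * x) ∨ ∀ t ∈ T, t ^ 4 = 1 := by
  rcases hT.abelian_or_hamiltonian with h | ⟨⟨⟨x, y, hxy⟩, -⟩, h2⟩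
  · exact Or.inl fun x hx y hy => congrArg Subtype.val (h ⟨x, hx⟩ ⟨y, hy⟩)
  · right
    intro t ht
    obtain ⟨a, b, h⟩ := exists_isQuaternionPair hT.finiteCyclicSubgroupsNormal
      (hT.mem_iff.1 x.2) (hT.mem_iff.1 y.2) (fun h => hxy (Subtype.ext h))
    obtain ⟨k, hk⟩ := h2 ⟨t, ht⟩
    exact h.pow_four_eq_one hT.finiteCyclicSubgroupsNormal (congrArg Subtype.val hk)

/-! ### Power endomorphisms of torsion abelian groups and zero divisors. -/

theorem MonoidHom.exists_eq_pow_of_mem_zpowers_pi {ι : Type*} [Fintype ι] {n : ι → ℕ}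
    [∀ i, NeZero (n i)]
    (f : ((i : ι) → Multiplicative (ZMod (n i))) →* ((i : ι) → Multiplicative (ZMod (n i))))
    (hf : ∀ a, f a ∈ Subgroup.zpowers a) : ∃ k : ℕ, ∀ a, f a = a ^ k := by
  classical
  let s : (i : ι) → Multiplicative (ZMod (n i)) := fun i => Multiplicative.ofAdd 1
  have hpow (x : (i : ι) → Multiplicative (ZMod (n i))) : ∃ k : ℕ, f x = x ^ k := by
    obtain ⟨k, hk⟩ := (isOfFinOrder_of_finite x).mem_powers_iff_mem_zpowers.2 (hf x)
    exact ⟨k, hk.symm⟩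
  -- The exponent at the all-ones element `s` restricts to every cyclic factor, so it serves for all
  -- of them.
  obtain ⟨k, hk⟩ := hpow s
  have hs : ∏ i, Pi.mulSingle i (s i) = s := Finset.univ_prod_mulSingle s
  have hbasis (i : ι) : f (Pi.mulSingle i (s i)) = Pi.mulSingle i (s i) ^ k := by
    choose l hl using fun i => hpow (Pi.mulSingle i (s i))
    have h1 : f s = ∏ i, (Pi.mulSingle i (s i) : (i : ι) → Multiplicative (ZMod (n i))) ^ l i := by
      conv_lhs => rw [← hs]
      rw [map_prod]
      exact Finset.prod_congr rfl fun i _ => hl i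
    have h2 := congrFun (h1.symm.trans hk) i
    simp only [← Pi.mulSingle_pow, Finset.univ_prod_mulSingle (fun i => s i ^ l i)] at h2
    rw [hl, ← Pi.mulSingle_pow, ← Pi.mulSingle_pow, h2, Pi.pow_apply]
  refine ⟨k, fun a => ?_⟩
  have : f = powMonoidHom k := by
    apply MonoidHom.functions_ext
    intro i x
    have hx : x = s i ^ (Multiplicative.toAdd x).val := by
      apply Multiplicative.toAdd.injective
      simp [s]
    rw [hx, Pi.mulSingle_pow, map_pow, hbasis, map_pow]
    rfl
  rw [this]
  rfl

theorem MonoidHom.exists_eq_pow_of_mem_zpowers {A : Type*} [CommGroup A] [Finite A] (f : A →* A)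
    (hf : ∀ a, f a ∈ Subgroup.zpowers a) : ∃ k : ℕ, ∀ a, f a = a ^ k := by
  obtain ⟨ι, _, n, hn, ⟨e⟩⟩ := CommGroup.equiv_prod_multiplicative_zmod_of_finite A
  have : ∀ i, NeZero (n i) := fun i => ⟨by have := hn i; omega⟩
  obtain ⟨k, hk⟩ := MonoidHom.exists_eq_pow_of_mem_zpowers_pi
    ((e.toMonoidHom.comp f).comp e.symm.toMonoidHom) (fun a => by
      obtain ⟨i, hi⟩ := hf (e.symm a)
      exact ⟨i, by simp [← hi]⟩)
  refine ⟨k, fun a => e.injective ?_⟩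
  simpa using hk (e a)

/-- Injectivity makes the exponent coprime to the order of `A`, so Dirichlet's theorem supplies
arbitrarily large primes in its residue class. -/
theorem MonoidHom.exists_prime_eq_pow_of_mem_zpowers {A : Type*} [CommGroup A] [Finite A]
    (f : A →* A) (hinj : Function.Injective f) (hf : ∀ a, f a ∈ Subgroup.zpowers a) (M : ℕ) :
    ∃ p > M, p.Prime ∧ ∀ a, f a = a ^ p := by
  obtain ⟨k, hk⟩ := f.exists_eq_pow_of_mem_zpowers hf
  have hcop : k.Coprime (Nat.card A) := by
    refine Nat.Coprime.symm (Nat.coprime_of_dvd fun q hq hqA hqk => ?_)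
    have := Fact.mk hq
    obtain ⟨a, ha⟩ := exists_prime_orderOf_dvd_card' q hqA
    have h1 : a = 1 := hinj (by
      rw [hk, map_one, ← orderOf_dvd_iff_pow_eq_one, ha]
      exact hqk)
    rw [h1, orderOf_one] at ha
    exact hq.one_lt.ne ha
  obtain ⟨p, hpM, hp, hpk⟩ := Nat.forall_exists_prime_gt_and_modEq M Nat.card_pos.ne' hcop
  refine ⟨p, hpM, hp, fun a => ?_⟩
  rw [hk, pow_eq_pow_iff_modEq]
  exact hpk.symm.of_dvd (orderOf_dvd_natCard a)

theorem MonoidHom.exists_prime_eqOn_pow_of_mem_zpowers {A : Type*} [CommGroup A]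
    (hA : ∀ a : A, IsOfFinOrder a) (f : A →* A) (hinj : Function.Injective f)
    (hf : ∀ a, f a ∈ Subgroup.zpowers a) (S : Finset A) (M : ℕ) :
    ∃ p > M, p.Prime ∧ ∀ a ∈ S, f a = a ^ p := by
  let B := Subgroup.closure (S : Set A)
  have hB : ∀ a ∈ B, f a ∈ B := fun a ha => Subgroup.zpowers_le.2 ha (hf a)
  have hfg : Group.FG B := (Group.fg_iff_subgroup_fg B).2 ⟨S, rfl⟩
  have hfin : Finite B := CommGroup.finite_of_fg_isMulTorsion B (fun b => by
    rw [← Submonoid.isOfFinOrder_coe]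
    exact hA _)
  let F : B →* B := (f.comp B.subtype).codRestrict B fun b => hB b b.2
  obtain ⟨p, hpM, hp, h⟩ := F.exists_prime_eq_pow_of_mem_zpowers
    (fun x y hxy => Subtype.ext (hinj (congrArg Subtype.val hxy)))
    (fun b => by
      obtain ⟨i, hi⟩ := hf b
      exact ⟨i, Subtype.ext hi⟩) M
  exact ⟨p, hpM, hp, fun a ha => congrArg Subtype.val (h ⟨a, Subgroup.subset_closure ha⟩)⟩

theorem MonoidAlgebra.mapRingHom_mapDomain_pow {A : Type*} [CommGroup A] (p : ℕ) [Fact p.Prime]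
    (x : MonoidAlgebra ℤ A) :
    mapRingHom A (Int.castRingHom (ZMod p)) (mapDomain (powMonoidHom p : A →* A) x) =
      mapRingHom A (Int.castRingHom (ZMod p)) x ^ p := by
  have : CharP (MonoidAlgebra (ZMod p) A) p :=
    charP_of_injective_algebraMap (algebraMap (ZMod p) (MonoidAlgebra (ZMod p) A)).injective p
  induction x using MonoidAlgebra.induction_linear with
  | zero => simp [(Fact.out : p.Prime).ne_zero]
  | add x y hx hy => rw [mapDomain_add, map_add, map_add, hx, hy, add_pow_char]
  | single a r => simp [single_pow]

/-- On the support of `x` the map `f` is the `p`-th power for some large prime `p`, so by Frobenius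
`f(x) y ≡ x ^ p y = 0` modulo `p`. A coefficient divisible by a prime exceeding its absolute value
is zero. -/
theorem MonoidAlgebra.mapDomain_mul_eq_zero {A : Type*} [CommGroup A]
    (hA : ∀ a : A, IsOfFinOrder a) (f : A →* A) (hinj : Function.Injective f)
    (hf : ∀ a, f a ∈ Subgroup.zpowers a) {x y : MonoidAlgebra ℤ A} (hxy : x * y = 0) :
    mapDomain f x * y = 0 := by
  ext a
  rw [coeff_zero, Finsupp.coe_zero, Pi.zero_apply]
  obtain ⟨p, hpM, hp, h⟩ := f.exists_prime_eqOn_pow_of_mem_zpowers hA hinj hf x.coeff.support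
    ((mapDomain f x * y).coeff a).natAbs
  have := Fact.mk hp
  have h1 : mapDomain f x = mapDomain (powMonoidHom p : A →* A) x := by
    ext1
    exact Finsupp.mapDomain_congr fun a ha => h a ha
  have h2 : mapRingHom A (Int.castRingHom (ZMod p)) (mapDomain f x * y) = 0 := by
    have h3 : ∀ n ≠ 0, mapRingHom A (Int.castRingHom (ZMod p)) x ^ n *
        mapRingHom A (Int.castRingHom (ZMod p)) y = 0 := fun n hn => by
      obtain ⟨m, rfl⟩ := Nat.exists_eq_succ_of_ne_zero hn
      rw [pow_succ, mul_assoc, ← map_mul, hxy, map_zero, mul_zero]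
    rw [map_mul, h1, mapRingHom_mapDomain_pow, h3 p hp.ne_zero]
  have h3 := congrArg (fun z => z.coeff a) h2
  simp only [coeff_mapRingHom, coeff_zero, Finsupp.coe_zero, Pi.zero_apply,
    eq_intCast, ZMod.intCast_zmod_eq_zero_iff_dvd] at h3
  exact Int.eq_zero_of_abs_lt_dvd h3 (by rw [Int.abs_eq_natAbs]; exact_mod_cast hpM)

/-! ### Homogeneous elements of the grading by `G ⧸ T`. -/

/-- The element `u` of `ℤG` is homogeneous of degree `q : G ⧸ T`, i.e. supported in the coset
`q`. -/
def IsHomogeneousOfCoset {G : Type*} [Group G] (T : Subgroup G) (q : G ⧸ T)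
    (u : MonoidAlgebra ℤ G) : Prop :=
  ∀ g, u.coeff g ≠ 0 → (g : G ⧸ T) = q

namespace IsHomogeneousOfCoset

variable {G : Type*} [Group G] {T : Subgroup G} {p q : G ⧸ T} {u v : MonoidAlgebra ℤ G}

theorem mul [T.Normal] (hu : IsHomogeneousOfCoset T p u) (hv : IsHomogeneousOfCoset T q v) :
    IsHomogeneousOfCoset T (p * q) (u * v) := by
  classical
  intro g hg
  obtain ⟨a, ha, b, hb, rfl⟩ := Finset.mem_mul.1
    (MonoidAlgebra.support_coeff_mul_subset u v (Finsupp.mem_support_iff.2 hg))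
  rw [QuotientGroup.mk_mul, hu a (Finsupp.mem_support_iff.1 ha),
    hv b (Finsupp.mem_support_iff.1 hb)]

theorem star [T.Normal] (hu : IsHomogeneousOfCoset T p u) :
    IsHomogeneousOfCoset T p⁻¹ (groupRingStar u) := by
  intro g hg
  rw [coeff_groupRingStar] at hg
  rw [← hu _ hg, QuotientGroup.mk_inv, inv_inv]

theorem of (T : Subgroup G) (g : G) : IsHomogeneousOfCoset T g (MonoidAlgebra.of ℤ G g) := by
  classical
  intro h hh
  have : g = h := by
    by_contra hne
    exact hh (by simp [hne])
  rw [this]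

theorem exists_eq_mapDomain (hu : IsHomogeneousOfCoset T (1 : G) u) :
    ∃ x : MonoidAlgebra ℤ T, MonoidAlgebra.mapDomain T.subtype x = u := by
  refine ⟨_, MonoidAlgebra.mapDomain_comapDomain ?_ T.subtype_injective⟩
  intro g hg
  have h1 := hu g (Finsupp.mem_support_iff.1 hg)
  rw [QuotientGroup.eq, mul_one, inv_mem_iff] at h1
  exact ⟨⟨g, h1⟩, rfl⟩

end IsHomogeneousOfCoset

/-- Conjugation fixes or inverts each `t` with `t ^ 4 = 1`, so `t + t⁻¹` is central. -/
theorem TorsionConditions.commute_add_groupRingStar {G : Type*} [Group G] {T : Subgroup G}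
    (hT : TorsionConditions T) (h4 : ∀ t ∈ T, t ^ 4 = 1) {u : MonoidAlgebra ℤ G}
    (hu : IsHomogeneousOfCoset T (1 : G) u) (v : MonoidAlgebra ℤ G) :
    Commute (u + groupRingStar u) v := by
  obtain ⟨x, rfl⟩ := hu.exists_eq_mapDomain
  clear hu
  have hsingle (t : T) (g : G) : Commute (MonoidAlgebra.of ℤ G t + MonoidAlgebra.of ℤ G (t : G)⁻¹)
      (MonoidAlgebra.of ℤ G g) := by
    rw [Commute, SemiconjBy, add_mul, mul_add, ← map_mul, ← map_mul, ← map_mul, ← map_mul]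
    rw [show (t : G) * g = g * (g⁻¹ * t * g) by group,
      show (t : G)⁻¹ * g = g * (g⁻¹ * t * g)⁻¹ by group]
    rcases hT.finiteCyclicSubgroupsNormal.conj_eq_or_eq_inv (h4 t t.2) g with h | h
    · rw [h]
    · rw [h, inv_inv, add_comm]
  induction x using MonoidAlgebra.induction_linear with
  | zero => simp
  | add x y hx hy =>
    rw [MonoidAlgebra.mapDomain_add, map_add, add_add_add_comm]
    exact hx.add_left hy
  | single t r =>
    rw [MonoidAlgebra.mapDomain_single, groupRingStar_single]
    have h1 (g : G) (r : ℤ) : MonoidAlgebra.single g r = r • MonoidAlgebra.of ℤ G g := by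
      simp
    rw [h1, h1, ← smul_add]
    refine Commute.smul_left ?_ r
    induction v using MonoidAlgebra.induction_linear with
    | zero => exact Commute.zero_right _
    | add x y hx hy => exact hx.add_right hy
    | single g s =>
      rw [h1 g]
      exact (hsingle t g).smul_right s

theorem MonoidAlgebra.commute_of_commute_add_self {G : Type*} [Group G] {x y : MonoidAlgebra ℤ G}
    (h : Commute (x + x) y) : Commute x y := by
  have h1 : x * y + x * y = y * x + y * x := by rw [← add_mul, ← mul_add, h.eq]
  show x * y = y * x
  ext g
  have h2 := congrArg (fun z => z.coeff g) h1
  simp only [coeff_add, Finsupp.add_apply] at h2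
  omega

theorem IsHomogeneousOfCoset.commute_of_abelian {G : Type*} [Group G] {T : Subgroup G}
    (hab : ∀ x ∈ T, ∀ y ∈ T, x * y = y * x) {u v : MonoidAlgebra ℤ G}
    (hu : IsHomogeneousOfCoset T (1 : G) u) (hv : IsHomogeneousOfCoset T (1 : G) v) :
    Commute u v := by
  obtain ⟨x, rfl⟩ := hu.exists_eq_mapDomain
  obtain ⟨y, rfl⟩ := hv.exists_eq_mapDomain
  let _ : CommGroup T :=
    { (inferInstance : Group T) with mul_comm := fun a b => Subtype.ext (hab a a.2 b b.2) }
  rw [Commute, SemiconjBy, ← MonoidAlgebra.mapDomain_mul, ← MonoidAlgebra.mapDomain_mul, mul_comm]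

theorem TorsionConditions.commute_of_groupRingStar_eq {G : Type*} [Group G] {T : Subgroup G}
    (hT : TorsionConditions T) {u v : MonoidAlgebra ℤ G}
    (hu : IsHomogeneousOfCoset T (1 : G) u) (hv : IsHomogeneousOfCoset T (1 : G) v)
    (hstar : groupRingStar u = u) : Commute u v := by
  rcases hT.abelian_or_pow_four with hab | h4
  · exact hu.commute_of_abelian hab hv
  · have := hT.commute_add_groupRingStar h4 hu v
    rw [hstar] at this
    exact MonoidAlgebra.commute_of_commute_add_self this

/-- For abelian `T`, moving `g` to the left conjugates `u` by a power automorphism, and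
`MonoidAlgebra.mapDomain_mul_eq_zero` applies. For exponent four, `u* u` is central, so `(u g v)* (u
g v)` contains the factor `u* u v = 0`. -/
theorem TorsionConditions.mul_of_mul_eq_zero {G : Type*} [Group G] {T : Subgroup G} [T.Normal]
    (hT : TorsionConditions T) {u v : MonoidAlgebra ℤ G}
    (hu : IsHomogeneousOfCoset T (1 : G) u) (hv : IsHomogeneousOfCoset T (1 : G) v)
    (huv : u * v = 0) (g : G) : u * MonoidAlgebra.of ℤ G g * v = 0 := by
  rcases hT.abelian_or_pow_four with hab | h4
  · obtain ⟨x, rfl⟩ := hu.exists_eq_mapDomain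
    obtain ⟨y, rfl⟩ := hv.exists_eq_mapDomain
    let _ : CommGroup T :=
      { (inferInstance : Group T) with mul_comm := fun a b => Subtype.ext (hab a a.2 b b.2) }
    rw [← MonoidAlgebra.mapDomain_mul] at huv
    have hxy : x * y = 0 := by
      apply MonoidAlgebra.mapDomain_injective T.subtype_injective
      rw [huv, MonoidAlgebra.mapDomain_zero]
    let f : T →* T := (MulAut.conjNormal g⁻¹ : MulAut T).toMonoidHom
    have hf (t : T) : (f t : G) = g⁻¹ * t * g := by
      simp [f]
    have h1 := MonoidAlgebra.mapDomain_mul_eq_zero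
      (fun t : T => by
        rw [← Submonoid.isOfFinOrder_coe]
        exact hT.mem_iff.1 t.2)
      f (MulAut.conjNormal g⁻¹ : MulAut T).injective (fun t => by
        obtain ⟨i, hi⟩ := hT.finiteCyclicSubgroupsNormal t g (hT.mem_iff.1 t.2)
        exact ⟨i, Subtype.ext (by rw [hf, ← hi]; rfl)⟩) hxy
    have h2 : MonoidAlgebra.mapDomain T.subtype x * MonoidAlgebra.of ℤ G g =
        MonoidAlgebra.of ℤ G g * MonoidAlgebra.mapDomain T.subtype (MonoidAlgebra.mapDomain f x) := by
      clear hu huv hxy h1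
      induction x using MonoidAlgebra.induction_linear with
      | zero => simp
      | add x y hx hy => simp only [MonoidAlgebra.mapDomain_add, add_mul, mul_add, hx, hy]
      | single t r =>
        simp [MonoidAlgebra.single_mul_single, hf, mul_assoc]
    rw [h2, mul_assoc, ← MonoidAlgebra.mapDomain_mul, h1, MonoidAlgebra.mapDomain_zero, mul_zero]
  · have hN : IsHomogeneousOfCoset T (1 : G) (groupRingStar u * u) := by
      have := hu.star.mul hu
      rwa [inv_mul_cancel] at this
    have hc (w : MonoidAlgebra ℤ G) : Commute (groupRingStar u * u) w := by
      have := hT.commute_add_groupRingStar h4 hN w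
      rw [groupRingStar_mul, groupRingStar_groupRingStar] at this
      exact MonoidAlgebra.commute_of_commute_add_self this
    apply eq_zero_of_groupRingStar_mul_self
    rw [groupRingStar_mul, groupRingStar_mul, groupRingStar_of]
    calc groupRingStar v * (MonoidAlgebra.of ℤ G g⁻¹ * groupRingStar u) *
          (u * MonoidAlgebra.of ℤ G g * v)
        = groupRingStar v * MonoidAlgebra.of ℤ G g⁻¹ * (groupRingStar u * u) *
          (MonoidAlgebra.of ℤ G g * v) := by simp only [mul_assoc]
      _ = groupRingStar v * MonoidAlgebra.of ℤ G g⁻¹ * MonoidAlgebra.of ℤ G g *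
          (groupRingStar u * (u * v)) := by
          rw [mul_assoc _ (groupRingStar u * u), ← mul_assoc (groupRingStar u * u), (hc _).eq]
          simp only [mul_assoc]
      _ = 0 := by rw [huv]; simp

/-- The symmetric element `u* u` commutes with `u*`, so its square is `u* u* u u = 0`. -/
theorem TorsionConditions.eq_zero_of_mul_self {G : Type*} [Group G] {T : Subgroup G} [T.Normal]
    (hT : TorsionConditions T) {u : MonoidAlgebra ℤ G}
    (hu : IsHomogeneousOfCoset T (1 : G) u) (huu : u * u = 0) : u = 0 := by
  have hstar : IsHomogeneousOfCoset T (1 : G) (groupRingStar u) := by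
    have := hu.star
    rwa [QuotientGroup.mk_one, inv_one] at this
  have hN : IsHomogeneousOfCoset T (1 : G) (groupRingStar u * u) := by
    have := hu.star.mul hu
    rwa [inv_mul_cancel] at this
  have hs : groupRingStar (groupRingStar u * u) = groupRingStar u * u := by
    rw [groupRingStar_mul, groupRingStar_groupRingStar]
  apply eq_zero_of_groupRingStar_mul_self
  apply eq_zero_of_groupRingStar_mul_self
  rw [hs, ← mul_assoc, (hT.commute_of_groupRingStar_eq hN hstar hs).eq, mul_assoc,
    mul_assoc (groupRingStar u), huu]
  simp

theorem TorsionConditions.mul_mul_of_mul_eq_zero {G : Type*} [Group G] {T : Subgroup G} [T.Normal]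
    (hT : TorsionConditions T) {p q : G ⧸ T} {u v : MonoidAlgebra ℤ G}
    (hu : IsHomogeneousOfCoset T p u) (hv : IsHomogeneousOfCoset T q v)
    (huv : u * v = 0) (r : MonoidAlgebra ℤ G) : u * r * v = 0 := by
  obtain ⟨g, rfl⟩ := QuotientGroup.mk_surjective p
  obtain ⟨h, rfl⟩ := QuotientGroup.mk_surjective q
  have h1 : IsHomogeneousOfCoset T (1 : G) (u * MonoidAlgebra.of ℤ G g⁻¹) := by
    have := hu.mul (IsHomogeneousOfCoset.of T g⁻¹)
    rwa [← QuotientGroup.mk_mul, mul_inv_cancel] at this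
  have h2 : IsHomogeneousOfCoset T (1 : G)
      (MonoidAlgebra.of ℤ G g * v * MonoidAlgebra.of ℤ G (h⁻¹ * g⁻¹)) := by
    have := ((IsHomogeneousOfCoset.of T g).mul hv).mul (IsHomogeneousOfCoset.of T (h⁻¹ * g⁻¹))
    rwa [← QuotientGroup.mk_mul, ← QuotientGroup.mk_mul,
      show g * h * (h⁻¹ * g⁻¹) = 1 by group] at this
  have hgg : MonoidAlgebra.of ℤ G g⁻¹ * MonoidAlgebra.of ℤ G g = 1 := by
    rw [← map_mul, inv_mul_cancel, map_one]
  have h3 := hT.mul_of_mul_eq_zero h1 h2 (by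
    calc u * MonoidAlgebra.of ℤ G g⁻¹ *
          (MonoidAlgebra.of ℤ G g * v * MonoidAlgebra.of ℤ G (h⁻¹ * g⁻¹))
        = u * (MonoidAlgebra.of ℤ G g⁻¹ * MonoidAlgebra.of ℤ G g) * v *
            MonoidAlgebra.of ℤ G (h⁻¹ * g⁻¹) := by simp only [mul_assoc]
      _ = 0 := by rw [hgg, mul_one, huv, zero_mul])
  have h4 (k : G) : u * MonoidAlgebra.of ℤ G k * v = 0 := by
    have h5 : MonoidAlgebra.of ℤ G g⁻¹ * MonoidAlgebra.of ℤ G (g * k * g⁻¹) *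
        MonoidAlgebra.of ℤ G g = MonoidAlgebra.of ℤ G k := by
      rw [← map_mul, ← map_mul]; congr 1; group
    have h6 : MonoidAlgebra.of ℤ G (h⁻¹ * g⁻¹) * MonoidAlgebra.of ℤ G (g * h) = 1 := by
      rw [← map_mul, show h⁻¹ * g⁻¹ * (g * h) = 1 by group, map_one]
    calc u * MonoidAlgebra.of ℤ G k * v
        = u * (MonoidAlgebra.of ℤ G g⁻¹ * MonoidAlgebra.of ℤ G (g * k * g⁻¹) *
            MonoidAlgebra.of ℤ G g) * v *
            (MonoidAlgebra.of ℤ G (h⁻¹ * g⁻¹) * MonoidAlgebra.of ℤ G (g * h)) := by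
          rw [h5, h6, mul_one]
      _ = u * MonoidAlgebra.of ℤ G g⁻¹ * MonoidAlgebra.of ℤ G (g * k * g⁻¹) *
            (MonoidAlgebra.of ℤ G g * v * MonoidAlgebra.of ℤ G (h⁻¹ * g⁻¹)) *
            MonoidAlgebra.of ℤ G (g * h) := by simp only [mul_assoc]
      _ = 0 := by rw [h3, zero_mul]
  induction r using MonoidAlgebra.induction_linear with
  | zero => simp
  | add x y hx hy => rw [mul_add, add_mul, hx, hy, add_zero]
  | single k s =>
    rw [show MonoidAlgebra.single k s = s • MonoidAlgebra.of ℤ G k by simp, mul_smul_comm,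
      smul_mul_assoc, h4, smul_zero]

theorem TorsionConditions.eq_zero_of_homogeneous_mul_self {G : Type*} [Group G] {T : Subgroup G}
    [T.Normal] (hT : TorsionConditions T) {p : G ⧸ T} {u : MonoidAlgebra ℤ G}
    (hu : IsHomogeneousOfCoset T p u) (huu : u * u = 0) : u = 0 := by
  have h1 := hT.mul_mul_of_mul_eq_zero hu hu huu
  obtain ⟨g, rfl⟩ := QuotientGroup.mk_surjective p
  have h2 : IsHomogeneousOfCoset T (1 : G) (u * MonoidAlgebra.of ℤ G g⁻¹) := by
    have := hu.mul (IsHomogeneousOfCoset.of T g⁻¹)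
    rwa [← QuotientGroup.mk_mul, mul_inv_cancel] at this
  have h3 := hT.eq_zero_of_mul_self h2 (by rw [← mul_assoc, h1, zero_mul])
  calc u = u * MonoidAlgebra.of ℤ G g⁻¹ * MonoidAlgebra.of ℤ G g := by
        rw [mul_assoc, ← map_mul, inv_mul_cancel, map_one, mul_one]
    _ = 0 := by rw [h3, zero_mul]

/-! ### Right order on the degrees, and symmetric units. -/

/-- A right multiple of `m` is sought behind which the elements of `L` multiply as in a domain. If
`m c c' = 0` with `m c`, `m c'` nonzero, pass to `m c`: it kills `c'` and still kills all that `m`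
killed, so the number of survivors drops. -/
theorem TorsionConditions.exists_mul_mul_ne_zero {G : Type*} [Group G] {T : Subgroup G}
    [T.Normal] (hT : TorsionConditions T) (L : Finset (MonoidAlgebra ℤ G))
    (hL : ∀ c ∈ L, ∃ q : G ⧸ T, IsHomogeneousOfCoset T q c) {p : G ⧸ T} {m : MonoidAlgebra ℤ G}
    (hm : IsHomogeneousOfCoset T p m) (hm0 : m ≠ 0) :
    ∃ (d : G ⧸ T) (r : MonoidAlgebra ℤ G), IsHomogeneousOfCoset T d (m * r) ∧ m * r ≠ 0 ∧
      ∀ c ∈ L, ∀ c' ∈ L, m * r * c ≠ 0 → m * r * c' ≠ 0 → m * r * c * c' ≠ 0 := by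
  classical
  induction h : (L.filter fun c => m * c ≠ 0).card using Nat.strong_induction_on
    generalizing m p with
  | _ n ih =>
    by_cases hall : ∀ c ∈ L, ∀ c' ∈ L, m * c ≠ 0 → m * c' ≠ 0 → m * c * c' ≠ 0
    · exact ⟨p, 1, by simpa using hm, by simpa using hm0, by simpa using hall⟩
    · push Not at hall
      obtain ⟨c, hc, c', hc', hmc, hmc', h0⟩ := hall
      obtain ⟨q, hq⟩ := hL c hc
      have hlt : (L.filter fun e => m * c * e ≠ 0).card < n := by
        rw [← h]
        apply Finset.card_lt_card
        refine Finset.ssubset_iff_subset_ne.2 ⟨fun e he => ?_, fun heq => ?_⟩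
        · obtain ⟨he, hne⟩ := Finset.mem_filter.1 he
          refine Finset.mem_filter.2 ⟨he, fun hme => hne ?_⟩
          obtain ⟨_, hq'⟩ := hL e he
          exact hT.mul_mul_of_mul_eq_zero hm hq' hme c
        · have : c' ∈ L.filter fun e => m * e ≠ 0 := Finset.mem_filter.2 ⟨hc', hmc'⟩
          rw [← heq] at this
          exact (Finset.mem_filter.1 this).2 h0
      obtain ⟨d, r, h1, h2, h3⟩ := ih _ hlt (hm.mul hq) hmc rfl
      exact ⟨d, c * r, by rwa [← mul_assoc], by rwa [← mul_assoc], by simpa only [← mul_assoc] using h3⟩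

/-- With `x` and `y` the extremes of `A`, the largest `xb` and the smallest `yc` are uniquely
represented, so both equal `1`. Then `xb = yc ≤ yb`, whence `x ≤ y`. -/
theorem IsRightOrderedGroup.eq_of_forall_unique_mul {Q : Type*} [Group Q]
    (hQ : IsRightOrderedGroup Q) {A B : Finset Q} (hB : B.Nonempty)
    (h : ∀ a ∈ A, ∀ b ∈ B, (∀ a' ∈ A, ∀ b' ∈ B, a' * b' = a * b → a' = a ∧ b' = b) → a * b = 1)
    {a a' : Q} (ha : a ∈ A) (ha' : a' ∈ A) : a = a' := by
  obtain ⟨_, hle⟩ := hQ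
  obtain ⟨x, hx, hxmax⟩ := A.exists_max_image id ⟨a, ha⟩
  obtain ⟨y, hy, hymin⟩ := A.exists_min_image id ⟨a, ha⟩
  obtain ⟨b, hb, hbmax⟩ := B.exists_max_image (fun b => x * b) hB
  obtain ⟨c, hc, hcmin⟩ := B.exists_min_image (fun b => y * b) hB
  have hxb := h x hx b hb fun a' ha' b' hb' heq => by
    have h1 : a' * b' = x * b' :=
      le_antisymm (hle _ _ _ (hxmax a' ha')) (heq ▸ hbmax b' hb')
    have h2 := mul_right_cancel h1
    subst h2
    exact ⟨rfl, mul_left_cancel heq⟩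
  have hyc := h y hy c hc fun a' ha' b' hb' heq => by
    have h1 : a' * b' = y * b' :=
      le_antisymm (heq ▸ hcmin b' hb') (hle _ _ _ (hymin a' ha'))
    have h2 := mul_right_cancel h1
    subst h2
    exact ⟨rfl, mul_left_cancel heq⟩
  have hxy : x ≤ y := by
    have h1 := hcmin b hb
    simp only [hyc, ← hxb] at h1
    have := hle _ _ b⁻¹ h1
    simpa using this
  have h1 : ∀ e ∈ A, e = x := fun e he =>
    le_antisymm (hxmax e he) (hxy.trans (hymin e he))
  rw [h1 a ha, h1 a' ha']

theorem IsRightOrderedGroup.eq_one_of_mul_self {Q : Type*} [Group Q]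
    (hQ : IsRightOrderedGroup Q) {q : Q} (h : q * q = 1) : q = 1 := by
  obtain ⟨_, hle⟩ := hQ
  rcases le_total 1 q with h1 | h1
  · have := hle _ _ q h1
    rw [h, one_mul] at this
    exact le_antisymm this h1
  · have := hle _ _ q h1
    rw [h, one_mul] at this
    exact le_antisymm h1 this

open Classical in
/-- The component of an element of `ℤG` supported in the coset `q`. -/
noncomputable def cosetComponent {G : Type*} [Group G] (T : Subgroup G) (q : G ⧸ T) :
    MonoidAlgebra ℤ G →+ MonoidAlgebra ℤ G where
  toFun x := MonoidAlgebra.ofCoeff (x.coeff.filter fun g => (g : G ⧸ T) = q)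
  map_zero' := by rw [MonoidAlgebra.coeff_zero, Finsupp.filter_zero]; rfl
  map_add' x y := by rw [MonoidAlgebra.coeff_add, Finsupp.filter_add]; rfl

section cosetComponent

variable {G : Type*} [Group G] {T : Subgroup G}

open Classical in
theorem coeff_cosetComponent (q : G ⧸ T) (x : MonoidAlgebra ℤ G) (g : G) :
    (cosetComponent T q x).coeff g = if (g : G ⧸ T) = q then x.coeff g else 0 :=
  Finsupp.filter_apply _ _ _

theorem isHomogeneousOfCoset_cosetComponent (q : G ⧸ T) (x : MonoidAlgebra ℤ G) :
    IsHomogeneousOfCoset T q (cosetComponent T q x) := fun g hg => by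
  classical
  by_contra h
  rw [coeff_cosetComponent, if_neg h] at hg
  exact hg rfl

theorem IsHomogeneousOfCoset.cosetComponent_eq_self {q : G ⧸ T} {x : MonoidAlgebra ℤ G}
    (hx : IsHomogeneousOfCoset T q x) : cosetComponent T q x = x := by
  classical
  ext g
  rw [coeff_cosetComponent]
  split_ifs with h
  · rfl
  · exact (not_not.1 fun hg => h (hx g hg)).symm

theorem IsHomogeneousOfCoset.cosetComponent_eq_zero {p q : G ⧸ T} {x : MonoidAlgebra ℤ G}
    (hx : IsHomogeneousOfCoset T q x) (hpq : p ≠ q) : cosetComponent T p x = 0 := by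
  classical
  ext g
  rw [coeff_cosetComponent]
  split_ifs with h
  · exact not_not.1 fun hg => hpq (h ▸ hx g hg)
  · rfl

theorem sum_cosetComponent {x : MonoidAlgebra ℤ G} {D : Finset (G ⧸ T)}
    (hD : ∀ q, cosetComponent T q x ≠ 0 → q ∈ D) : ∑ q ∈ D, cosetComponent T q x = x := by
  classical
  ext g
  simp only [MonoidAlgebra.coeff_sum, Finsupp.finsetSum_apply, coeff_cosetComponent,
    Finset.sum_ite_eq]
  split_ifs with h
  · rfl
  · by_contra hg
    refine h (hD _ fun h0 => hg ?_)
    have := coeff_cosetComponent (g : G ⧸ T) x g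
    rw [h0, if_pos rfl] at this
    exact this

theorem exists_finset_cosetComponent (x : MonoidAlgebra ℤ G) :
    ∃ D : Finset (G ⧸ T), ∀ q, cosetComponent T q x ≠ 0 → q ∈ D := by
  classical
  refine ⟨x.coeff.support.image (fun g : G => (g : G ⧸ T)), fun q hq => ?_⟩
  obtain ⟨g, hg⟩ : ∃ g, (cosetComponent T q x).coeff g ≠ 0 := by
    by_contra! h
    exact hq (by ext g; simpa using h g)
  rw [coeff_cosetComponent] at hg
  split_ifs at hg with h
  · exact Finset.mem_image.2 ⟨g, Finsupp.mem_support_iff.2 hg, h⟩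
  · exact absurd rfl hg

theorem groupRingStar_cosetComponent [T.Normal] (q : G ⧸ T) (x : MonoidAlgebra ℤ G) :
    groupRingStar (cosetComponent T q x) = cosetComponent T q⁻¹ (groupRingStar x) := by
  classical
  ext g
  simp only [coeff_groupRingStar, coeff_cosetComponent, QuotientGroup.mk_inv, inv_eq_iff_eq_inv]

end cosetComponent

/-- Otherwise let `m` be a right multiple of the nonzero product, as in
`TorsionConditions.exists_mul_mul_ne_zero`, for all components of `x` and `y`. Expand `m = m x y`
over the degrees not killed by `m`: a uniquely represented `ab` gives a nonzero component in degree
`d a b`, so `ab = 1` because `m` has degree `d`. Only one degree of `x` can then survive, yet both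
`q` and `q'` do. -/
theorem TorsionConditions.cosetComponent_mul_eq_zero {G : Type*} [Group G] {T : Subgroup G}
    [T.Normal] (hT : TorsionConditions T) (hQ : IsRightOrderedGroup (G ⧸ T))
    {x y : MonoidAlgebra ℤ G} (hxy : x * y = 1) (hyx : y * x = 1) {q q' : G ⧸ T} (hqq : q ≠ q') :
    cosetComponent T q x * cosetComponent T q' x = 0 := by
  classical
  by_contra hne
  obtain ⟨Dx, hDx⟩ := exists_finset_cosetComponent (T := T) x
  obtain ⟨Dy, hDy⟩ := exists_finset_cosetComponent (T := T) y
  have hhom := isHomogeneousOfCoset_cosetComponent (T := T)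
  obtain ⟨d, r, hm, hm0, hL⟩ := hT.exists_mul_mul_ne_zero
    (Dx.image (fun q => cosetComponent T q x) ∪ Dy.image (fun q => cosetComponent T q y))
    (fun c hc => by
      rcases Finset.mem_union.1 hc with hc | hc
      · obtain ⟨q, -, rfl⟩ := Finset.mem_image.1 hc
        exact ⟨q, hhom q x⟩
      · obtain ⟨q, -, rfl⟩ := Finset.mem_image.1 hc
        exact ⟨q, hhom q y⟩) ((hhom q x).mul (hhom q' x)) hne
  obtain ⟨m, hmdef⟩ : ∃ m, m = cosetComponent T q x * cosetComponent T q' x * r := ⟨_, rfl⟩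
  rw [← hmdef] at hm hm0 hL
  have hright {z : MonoidAlgebra ℤ G} {p : G ⧸ T} (h : m * cosetComponent T p z ≠ 0) :
      cosetComponent T p z ≠ 0 := fun h0 => h (by rw [h0, mul_zero])
  -- The second factor of `m * m` begins with the components of degrees `q` and `q'`, so if `m`
  -- killed either one then `m * m = 0`.
  have hmq : m * cosetComponent T q x ≠ 0 := fun h => hm0 (by
    apply hT.eq_zero_of_homogeneous_mul_self hm
    nth_rewrite 2 [hmdef]
    rw [← mul_assoc, ← mul_assoc, h, zero_mul, zero_mul])
  have hmq' : m * cosetComponent T q' x ≠ 0 := fun h => hm0 (by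
    apply hT.eq_zero_of_homogeneous_mul_self hm
    nth_rewrite 2 [hmdef]
    rw [← mul_assoc, ← mul_assoc, hT.mul_mul_of_mul_eq_zero hm (hhom q' x) h, zero_mul])
  let A := Dx.filter fun a => m * cosetComponent T a x ≠ 0
  let B := Dy.filter fun b => m * cosetComponent T b y ≠ 0
  have hB : B.Nonempty := by
    by_contra hB
    rw [Finset.not_nonempty_iff_eq_empty, Finset.filter_eq_empty_iff] at hB
    apply hm0
    have hmy : m * y = 0 := by
      rw [← sum_cosetComponent hDy, Finset.mul_sum]
      exact Finset.sum_eq_zero fun b hb => not_not.1 (hB hb)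
    rw [← mul_one m, ← hyx, ← mul_assoc, hmy, zero_mul]
  have hmxy : m = ∑ a ∈ Dx, ∑ b ∈ Dy, m * cosetComponent T a x * cosetComponent T b y := by
    simp only [← Finset.mul_sum, sum_cosetComponent hDy, ← Finset.sum_mul, sum_cosetComponent hDx]
    rw [mul_assoc, hxy, mul_one]
  refine hqq (hQ.eq_of_forall_unique_mul (A := A) hB ?_
    (Finset.mem_filter.2 ⟨hDx _ (hright hmq), hmq⟩)
    (Finset.mem_filter.2 ⟨hDx _ (hright hmq'), hmq'⟩))
  intro a ha b hb huniq
  obtain ⟨ha, hma⟩ := Finset.mem_filter.1 ha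
  obtain ⟨hb, hmb⟩ := Finset.mem_filter.1 hb
  have hdeg (a' b' : G ⧸ T) : IsHomogeneousOfCoset T (d * a' * b')
      (m * cosetComponent T a' x * cosetComponent T b' y) := (hm.mul (hhom a' x)).mul (hhom b' y)
  have hzero (a' : G ⧸ T) (ha' : a' ∈ Dx) (b' : G ⧸ T) (hb' : b' ∈ Dy) (h : ¬ (a' = a ∧ b' = b)) :
      cosetComponent T (d * a * b) (m * cosetComponent T a' x * cosetComponent T b' y) = 0 := by
    by_cases hA : m * cosetComponent T a' x = 0
    · rw [hA, zero_mul, map_zero]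
    by_cases hB : m * cosetComponent T b' y = 0
    · rw [hT.mul_mul_of_mul_eq_zero hm (hhom b' y) hB, map_zero]
    refine (hdeg a' b').cosetComponent_eq_zero fun heq => h ?_
    rw [mul_assoc, mul_assoc, mul_right_inj] at heq
    exact huniq a' (Finset.mem_filter.2 ⟨ha', hA⟩) b' (Finset.mem_filter.2 ⟨hb', hB⟩) heq.symm
  have hcomp : cosetComponent T (d * a * b) m =
      m * cosetComponent T a x * cosetComponent T b y := by
    conv_lhs => rw [hmxy]
    rw [map_sum, Finset.sum_eq_single_of_mem a ha, map_sum, Finset.sum_eq_single_of_mem b hb,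
      (hdeg a b).cosetComponent_eq_self]
    · exact fun b' hb' hne => hzero a ha b' hb' fun h => hne h.2
    · intro a' ha' hne
      rw [map_sum]
      exact Finset.sum_eq_zero fun b' hb' => hzero a' ha' b' hb' fun h => hne h.1
  by_contra hab
  rw [hm.cosetComponent_eq_zero (by rwa [mul_assoc, Ne, mul_eq_left])] at hcomp
  exact hL _ (Finset.mem_union_left _ (Finset.mem_image_of_mem _ ha)) _
    (Finset.mem_union_right _ (Finset.mem_image_of_mem _ hb)) hma hmb hcomp.symm

theorem TorsionConditions.isHomogeneousOfCoset_of_mem_symmetricUnits {G : Type*} [Group G]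
    {T : Subgroup G} [T.Normal] (hT : TorsionConditions T) (hQ : IsRightOrderedGroup (G ⧸ T))
    {x : (MonoidAlgebra ℤ G)ˣ} (hx : x ∈ symmetricUnits G) :
    IsHomogeneousOfCoset T (1 : G) (x : MonoidAlgebra ℤ G) := by
  classical
  intro g hg
  by_contra hne
  have h1 : (g : G ⧸ T) ≠ (g : G ⧸ T)⁻¹ := fun h => hne (hQ.eq_one_of_mul_self (by
    nth_rewrite 2 [h]
    exact mul_inv_cancel _))
  have h2 := hT.cosetComponent_mul_eq_zero hQ x.mul_inv x.inv_mul h1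
  have hx' : groupRingStar (x : MonoidAlgebra ℤ G) = x := hx
  nth_rewrite 2 [← hx'] at h2
  rw [← groupRingStar_cosetComponent] at h2
  have h3 := coeff_cosetComponent (g : G ⧸ T) (x : MonoidAlgebra ℤ G) g
  rw [eq_zero_of_mul_groupRingStar_self h2, if_pos rfl] at h3
  exact hg h3.symm

theorem mainTheorem1 (G : Type*) [Group G] :
    (SymmetricUnitsFormSubgroup G → ∃ T : Subgroup G, TorsionConditions T) ∧
    (∀ (T : Subgroup G) (hT : TorsionConditions T),
      (haveI : T.Normal := hT.normal_of_le T le_rfl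
       IsRightOrderedGroup (G ⧸ T)) →
      SymmetricUnitsFormSubgroup G) := by
  refine ⟨fun h => exists_torsionConditions_of_symmetricUnits_commute
    (symmetricUnitsFormSubgroup_iff.1 h), fun T hT hQ => symmetricUnitsFormSubgroup_iff.2 ?_⟩
  have : T.Normal := hT.normal_of_le T le_rfl
  intro x hx y hy
  exact Units.ext (hT.commute_of_groupRingStar_eq
    (hT.isHomogeneousOfCoset_of_mem_symmetricUnits hQ hx)
    (hT.isHomogeneousOfCoset_of_mem_symmetricUnits hQ hy) hx)
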